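/- Let $a$ be a nonzero integer and let $A=\mathbb{C}[x]$ be graded by $\deg x=a$. Let $W\in A$ be homogeneous of degree $d\in\mathbb{Z}$, with $W(0)=0$ and such that $(W=0)\subset\mathbb{C}$ has no singular point other than possibly the origin (so $W=c\,x^m$ with $c\in\mathbb{C}^*$, $m\ge 1$ and $d=am$). For a graded $A$-module $P$ let $P(k)$ denote the graded module with $P(k)_i=P_{i+k}$. A graded matrix factorization of $W$ is a pair of homomorphisms of graded $A$-modules $$P^\bullet=\big(P^0\xrightarrow{p^0}P^1\xrightarrow{p^1}P^0(d)\big),\qquad p^1\circ p^0=W,\quad p^0(d)\circ p^1=W,$$ where $P^0,P^1$ are graded free $A$-modules of finite rank. Let $\mathrm{HMF}^{\mathrm{gr}}(W)$ be the homotopy category of graded matrix factorizations of $W$, a triangulated category whose shift $[1]$ sends $P^\bullet$ to $\big(P^1\xrightarrow{-p^1}P^0(d)\xrightarrow{-p^0(d)}P^1(d)\big)$ and whose distinguished triangles are those isomorphic to triangles of mapping cones. Let $\tau$ be the autoequivalence of $\mathrm{HMF}^{\mathrm{gr}}(W)$ induced by $P^\bullet\mapsto P^\bullet(1)$. A (Bridgeland)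 stability condition on a triangulated category $\mathcal{D}$ is a pair $(Z,\{\mathcal{P}(\phi)\}_{\phi\in\mathbb{R}})$ of a group homomorphism $Z\colon K(\mathcal{D})\to\mathbb{C}$ and full additive subcategories $\mathcal{P}(\phi)\subset\mathcal{D}$, closed under isomorphism, such that: $Z(E)\in\mathbb{R}_{>0}\,e^{\pi\sqrt{-1}\phi}$ for $0\ne E\in\mathcal{P}(\phi)$; $\mathcal{P}(\phi+1)=\mathcal{P}(\phi)[1]$; $\mathrm{Hom}(E_1,E_2)=0$ for $E_i\in\mathcal{P}(\phi_i)$ with $\phi_1>\phi_2$; and for each $0\ne E\in\mathcal{D}$ there are distinguished triangles $E_{i-1}\to E_i\to F_i\to E_{i-1}[1]$ $(1\le i\le N)$ with $E_0=0$, $E_N=E$, $F_i\in\mathcal{P}(\phi_i)$ and $\phi_1>\cdots>\phi_N$. Then there is a stability condition $\sigma_G=(Z_G,\{\mathcal{P}_G(\phi)\}_{\phi\in\mathbb{R}})$ on $\mathrm{HMF}^{\mathrm{gr}}(W)$ with the following properties. 1. For each graded matrix factorization with $P^i\cong\bigoplus_{j}A(n_{i,j})$ one has $$Z_G(P^\bullet)=\sum_{j}e^{2\pi\sqrt{-1}\,n_{0,j}/d}-\sum_{j}e^{2\pi\sqrt{-1}\,n_{1,j}/d}.$$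 2. $\sigma_G$ is of Gepner type with respect to $(\tau,2/d)$, that is $$Z_G\circ\tau^{-1}=e^{-2\pi\sqrt{-1}/d}\,Z_G,\qquad \tau(\mathcal{P}_G(\phi))=\mathcal{P}_G(\phi+2/d)\quad\text{for all }\phi\in\mathbb{R}.$$ 3. $\sigma_G$ has the support property: there are a free abelian group $\Gamma$ of finite rank, a norm $\|\cdot\|$ on $\Gamma\otimes\mathbb{R}$, a homomorphism $v\colon K(\mathrm{HMF}^{\mathrm{gr}}(W))\to\Gamma$ through which $Z_G$ factors, and a constant $C$ such that $\|v(E)\|\le C\,|Z_G(E)|$ for all $\phi\in\mathbb{R}$ and $E\in\mathcal{P}_G(\phi)$. -/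

import Mathlib

open CategoryTheory CategoryTheory.Limits

section MatrixFactorizations

variable {A : Type} [CommRing A] [Algebra ℂ A]

/-- A `ℤ/2`-graded module `P = P⁰ ⊕ P¹` whose components are graded free modules of finite rank
over a graded ring `A`, with chosen homogeneous bases: the basis elements of `Pᵖ` are the `j : ι`
with `par j = p`, and `Pᵖ = ⨁_{par j = p} A(deg j)`, where `A(k)ᵢ = A_{k+i}`. -/
structure GradedSuperModule where
  ι : Type
  [fintype : Fintype ι]
  [decEq : DecidableEq ι]
  par : ι → ZMod 2
  deg : ι → ℤ

attribute [instance] GradedSuperModule.fintype GradedSuperModule.decEq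

namespace GradedSuperModule

/-- If `A(g)` is a summand of `Pᵖ`, then it contributes to `P[n]` the summand `A(g + d c)` of
`P[n]^q = P^{q+n} = Pᵖ(d c)`, where `q ∈ {0, 1}`, `q ≡ p - n` modulo 2 and `q + n = p + 2 c`.
This is the number `c`. -/
def carry (p : ZMod 2) (n : ℤ) : ℤ := (((p - n : ZMod 2).val : ℤ) + n - (p.val : ℤ)) / 2

lemma carry_spec (p : ZMod 2) (n : ℤ) :
    ((p - n : ZMod 2).val : ℤ) + n = (p.val : ℤ) + 2 * carry p n := by
  have h : (2 : ℤ) ∣ ((p - n : ZMod 2).val : ℤ) + n - (p.val : ℤ) := by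
    have := (ZMod.intCast_zmod_eq_zero_iff_dvd (((p - n : ZMod 2).val : ℤ) + n - (p.val : ℤ)) 2).1
      (by push_cast; simp)
    simpa using this
  unfold carry
  omega

/-- The underlying module of the shift `P[n]`, with `P[n]ⁱ = Pⁱ⁺ⁿ`. -/
def shift (P : GradedSuperModule) (d n : ℤ) : GradedSuperModule where
  ι := P.ι
  par i := P.par i - n
  deg i := P.deg i + d * carry (P.par i) n

lemma carry_zero (p : ZMod 2) : carry p 0 = 0 := by
  have := carry_spec p 0
  simp at this
  omega

lemma carry_add (p : ZMod 2) (m n : ℤ) : carry p (m + n) = carry p m + carry (p - m) n := by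
  have h₁ := carry_spec p (m + n)
  have h₂ := carry_spec p m
  have h₃ := carry_spec (p - m) n
  have : (p - (m + n : ℤ) : ZMod 2) = p - m - n := by push_cast; ring
  rw [this] at h₁
  omega

end GradedSuperModule

/-- The matrix `M` (acting on column vectors) is a homomorphism of graded modules from `P` to `Q`
of cohomological degree `e`. Both are unrolled to `ℤ`-indexed families by `P^{i+2} = Pⁱ(d)`, and
the component of `M` from `Pᵖ` to `Pᵖ⁺ᵉ`, `p ∈ {0, 1}`, is a degree preserving map. So the entry
from the summand `A(deg i)` of `Pᵖ` to the summand `A(deg k)` of `Q^q` vanishes unless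
`p + e = q + 2 c` for an integer `c`, and is then an element of `A` of degree
`(deg k + d c) - deg i`. -/
def IsHomogeneousOfDegree (𝒜 : ℤ → Submodule ℂ A) (d : ℤ) (P Q : GradedSuperModule) (e : ℤ)
    (M : Matrix Q.ι P.ι A) : Prop :=
  ∀ k i, M k i = 0 ∨ ∃ c : ℤ, ((P.par i).val : ℤ) + e = (Q.par k).val + 2 * c ∧
    M k i ∈ 𝒜 (Q.deg k + d * c - P.deg i)

namespace IsHomogeneousOfDegree

variable {𝒜 : ℤ → Submodule ℂ A} {d : ℤ} {P Q R : GradedSuperModule} {e e' : ℤ}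

lemma zero : IsHomogeneousOfDegree 𝒜 d P Q e 0 := fun _ _ => Or.inl rfl

lemma add {M N : Matrix Q.ι P.ι A} (hM : IsHomogeneousOfDegree 𝒜 d P Q e M)
    (hN : IsHomogeneousOfDegree 𝒜 d P Q e N) : IsHomogeneousOfDegree 𝒜 d P Q e (M + N) := by
  intro k i
  rw [Matrix.add_apply]
  rcases hM k i with h | ⟨c, hc, h⟩
  · rw [h, zero_add]; exact hN k i
  rcases hN k i with h' | ⟨c', hc', h'⟩
  · rw [h', add_zero]; exact Or.inr ⟨c, hc, h⟩
  obtain rfl : c' = c := by omega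
  exact Or.inr ⟨c', hc, add_mem h h'⟩

lemma neg {M : Matrix Q.ι P.ι A} (hM : IsHomogeneousOfDegree 𝒜 d P Q e M) :
    IsHomogeneousOfDegree 𝒜 d P Q e (-M) := by
  intro k i
  rcases hM k i with h | ⟨c, hc, h⟩
  · left; simp [h]
  · exact Or.inr ⟨c, hc, neg_mem h⟩

lemma sub {M N : Matrix Q.ι P.ι A} (hM : IsHomogeneousOfDegree 𝒜 d P Q e M)
    (hN : IsHomogeneousOfDegree 𝒜 d P Q e N) : IsHomogeneousOfDegree 𝒜 d P Q e (M - N) := by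
  rw [sub_eq_add_neg]; exact hM.add hN.neg

lemma units_smul {M : Matrix Q.ι P.ι A} (hM : IsHomogeneousOfDegree 𝒜 d P Q e M) (u : ℤˣ) :
    IsHomogeneousOfDegree 𝒜 d P Q e (u • M) := by
  rcases Int.units_eq_one_or u with rfl | rfl
  · simpa using hM
  · simpa using hM.neg

lemma one [SetLike.GradedMonoid 𝒜] : IsHomogeneousOfDegree 𝒜 d P P 0 1 := by
  intro k i
  by_cases h : k = i
  · subst h
    refine Or.inr ⟨0, by simp, ?_⟩
    simpa using SetLike.GradedOne.one_mem
  · exact Or.inl (Matrix.one_apply_ne h)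

lemma mul [SetLike.GradedMonoid 𝒜] {M : Matrix R.ι Q.ι A} {N : Matrix Q.ι P.ι A}
    (hM : IsHomogeneousOfDegree 𝒜 d Q R e M) (hN : IsHomogeneousOfDegree 𝒜 d P Q e' N) :
    IsHomogeneousOfDegree 𝒜 d P R (e + e') (M * N) := by
  intro k i
  rw [Matrix.mul_apply]
  refine Finset.sum_induction (fun j => M k j * N j i)
    (fun x => x = 0 ∨ ∃ c : ℤ, ((P.par i).val : ℤ) + (e + e') = (R.par k).val + 2 * c ∧
      x ∈ 𝒜 (R.deg k + d * c - P.deg i)) ?_ (Or.inl rfl) ?_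
  · rintro x y (rfl | ⟨c, hc, h⟩) (rfl | ⟨c', hc', h'⟩)
    · left; simp
    · right; simpa using ⟨c', hc', h'⟩
    · right; simpa using ⟨c, hc, h⟩
    · obtain rfl : c' = c := by omega
      exact Or.inr ⟨c', hc, add_mem h h'⟩
  · intro j _
    rcases hM k j with h | ⟨c, hc, h⟩
    · left; simp [h]
    rcases hN j i with h' | ⟨c', hc', h'⟩
    · left; simp [h']
    refine Or.inr ⟨c + c', by omega, ?_⟩
    have := SetLike.GradedMul.mul_mem h h'
    convert! this using 2
    ring

lemma shift {m n : ℤ} {M : Matrix Q.ι P.ι A} (h : IsHomogeneousOfDegree 𝒜 d P Q e' M) (he : e' = e + n - m) :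
    IsHomogeneousOfDegree 𝒜 d (P.shift d m) (Q.shift d n) e M := by
  intro k i
  rcases h k i with h | ⟨c, hc, h⟩
  · exact Or.inl h
  have h₁ := GradedSuperModule.carry_spec (P.par i) m
  have h₂ := GradedSuperModule.carry_spec (Q.par k) n
  refine Or.inr ⟨c + GradedSuperModule.carry (P.par i) m - GradedSuperModule.carry (Q.par k) n, ?_, ?_⟩
  · dsimp [GradedSuperModule.shift]
    omega
  · dsimp [GradedSuperModule.shift]
    convert! h using 2
    ring

lemma shift_left {m : ℤ} {M : Matrix Q.ι P.ι A} (h : IsHomogeneousOfDegree 𝒜 d P Q e' M) (he : e' = e - m) :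
    IsHomogeneousOfDegree 𝒜 d (P.shift d m) Q e M := by
  intro k i
  rcases h k i with h | ⟨c, hc, h⟩
  · exact Or.inl h
  have h₁ := GradedSuperModule.carry_spec (P.par i) m
  refine Or.inr ⟨c + GradedSuperModule.carry (P.par i) m, ?_, ?_⟩
  · dsimp [GradedSuperModule.shift]
    omega
  · dsimp [GradedSuperModule.shift]
    convert! h using 2
    ring

lemma shift_right {n : ℤ} {M : Matrix Q.ι P.ι A} (h : IsHomogeneousOfDegree 𝒜 d P Q e' M) (he : e' = e + n) :
    IsHomogeneousOfDegree 𝒜 d P (Q.shift d n) e M := by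
  intro k i
  rcases h k i with h | ⟨c, hc, h⟩
  · exact Or.inl h
  have h₂ := GradedSuperModule.carry_spec (Q.par k) n
  refine Or.inr ⟨c - GradedSuperModule.carry (Q.par k) n, ?_, ?_⟩
  · dsimp [GradedSuperModule.shift]
    omega
  · dsimp [GradedSuperModule.shift]
    convert! h using 2
    ring

lemma twist {M : Matrix Q.ι P.ι A}
    (h : IsHomogeneousOfDegree 𝒜 d P Q e M) (r : ℤ) :
    IsHomogeneousOfDegree 𝒜 d ⟨P.ι, P.par, fun i => P.deg i + r⟩ ⟨Q.ι, Q.par, fun i => Q.deg i + r⟩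
      e M := by
  intro k i
  rcases h k i with h | ⟨c, hc, h⟩
  · exact Or.inl h
  · refine Or.inr ⟨c, hc, ?_⟩
    convert! h using 2
    dsimp only
    ring

end IsHomogeneousOfDegree

/-- A graded matrix factorization `P⁰ → P¹ → P⁰(d)` of `W`, in the graded ring `A = ⨁ 𝒜 i`:
graded free modules `P⁰`, `P¹` of finite rank, and a map `diff = p⁰ + p¹` with components
`p⁰ : P⁰ → P¹` and `p¹ : P¹ → P⁰(d)` such that `p¹ ∘ p⁰ = W` and `p⁰(d) ∘ p¹ = W`. -/
structure GradedMF (𝒜 : ℤ → Submodule ℂ A) (d : ℤ) (W : A) extends GradedSuperModule where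
  diff : Matrix ι ι A
  homogeneous : IsHomogeneousOfDegree 𝒜 d toGradedSuperModule toGradedSuperModule 1 diff
  diff_mul_diff : diff * diff = Matrix.scalar ι W

namespace GradedMF

variable {𝒜 : ℤ → Submodule ℂ A} {d : ℤ} {W : A}

/-- Morphisms of matrix factorizations: pairs `f⁰ : P⁰ → Q⁰`, `f¹ : P¹ → Q¹` of homomorphisms of
graded modules (the components of `mat`) which commute with the structure maps. -/
@[ext]
structure Hom (P Q : GradedMF 𝒜 d W) where
  mat : Matrix Q.ι P.ι A
  homogeneous : IsHomogeneousOfDegree 𝒜 d P.toGradedSuperModule Q.toGradedSuperModule 0 mat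
  comm : mat * P.diff = Q.diff * mat

variable [SetLike.GradedMonoid 𝒜]

instance : Category (GradedMF 𝒜 d W) where
  Hom := Hom
  id P := ⟨1, .one, by simp⟩
  comp f g := ⟨g.mat * f.mat, by simpa using g.homogeneous.mul f.homogeneous, by
    rw [Matrix.mul_assoc, f.comm, ← Matrix.mul_assoc, g.comm, Matrix.mul_assoc]⟩
  id_comp f := Hom.ext (Matrix.mul_one _)
  comp_id f := Hom.ext (Matrix.one_mul _)
  assoc f g h := Hom.ext (Matrix.mul_assoc _ _ _).symm

variable {P Q R : GradedMF 𝒜 d W}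

/-- The matrix of a morphism. -/
def mat (f : P ⟶ Q) : Matrix Q.ι P.ι A := Hom.mat f

lemma hom_ext {f g : P ⟶ Q} (h : mat f = mat g) : f = g := Hom.ext h

lemma homogeneous_mat (f : P ⟶ Q) :
    IsHomogeneousOfDegree 𝒜 d P.toGradedSuperModule Q.toGradedSuperModule 0 (mat f) :=
  Hom.homogeneous f

lemma comm (f : P ⟶ Q) : mat f * P.diff = Q.diff * mat f := Hom.comm f

/-- Constructor for morphisms. -/
def homMk (M : Matrix Q.ι P.ι A)
    (h : IsHomogeneousOfDegree 𝒜 d P.toGradedSuperModule Q.toGradedSuperModule 0 M)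
    (hM : M * P.diff = Q.diff * M) : P ⟶ Q := ⟨M, h, hM⟩

@[simp] lemma mat_homMk (M : Matrix Q.ι P.ι A) (h) (hM) : mat (homMk M h hM : P ⟶ Q) = M := rfl
@[simp] lemma mat_id (P : GradedMF 𝒜 d W) : mat (𝟙 P) = 1 := rfl
@[simp] lemma mat_comp (f : P ⟶ Q) (g : Q ⟶ R) : mat (f ≫ g) = mat g * mat f := rfl

instance : Zero (P ⟶ Q) := ⟨homMk 0 .zero (by simp)⟩
instance : Add (P ⟶ Q) := ⟨fun f g => homMk (mat f + mat g)
  ((homogeneous_mat f).add (homogeneous_mat g)) (by rw [Matrix.add_mul, Matrix.mul_add, comm, comm])⟩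
instance : Neg (P ⟶ Q) := ⟨fun f => homMk (-mat f) (homogeneous_mat f).neg (by simp [comm])⟩

@[simp] lemma mat_zero : mat (0 : P ⟶ Q) = 0 := rfl
@[simp] lemma mat_add (f g : P ⟶ Q) : mat (f + g) = mat f + mat g := rfl
@[simp] lemma mat_neg (f : P ⟶ Q) : mat (-f) = -mat f := rfl

instance : AddCommGroup (P ⟶ Q) where
  add_assoc f g h := hom_ext (by simp [add_assoc])
  zero_add f := hom_ext (by simp)
  add_zero f := hom_ext (by simp)
  nsmul := nsmulRec
  zsmul := zsmulRec
  neg_add_cancel f := hom_ext (by simp)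
  add_comm f g := hom_ext (by simp [add_comm])

@[simp] lemma mat_sub (f g : P ⟶ Q) : mat (f - g) = mat f - mat g := by
  rw [sub_eq_add_neg, sub_eq_add_neg]; rfl

lemma mat_units_smul (u : ℤˣ) (f : P ⟶ Q) : mat (u • f) = u • mat f := by
  rcases Int.units_eq_one_or u with rfl | rfl <;> simp

instance : Preadditive (GradedMF 𝒜 d W) where
  add_comp _ _ _ f g h := hom_ext (Matrix.mul_add _ _ _)
  comp_add _ _ _ f g h := hom_ext (Matrix.add_mul _ _ _)

/-- An isomorphism from an invertible pair of matrices. -/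
def isoMk (f : P ⟶ Q) (g : Q ⟶ P) (h₁ : mat g * mat f = 1) (h₂ : mat f * mat g = 1) : P ≅ Q where
  hom := f
  inv := g
  hom_inv_id := hom_ext h₁
  inv_hom_id := hom_ext h₂

/-! ### The shift functors -/

/-- The shift `P[n]` of a matrix factorization, whose structure maps are those of `P` multiplied
by `(-1)ⁿ`. In particular `P[1]` is `P¹ → P⁰(d) → P¹(d)` with the maps `-p¹` and `-p⁰(d)`. -/
def shift (P : GradedMF 𝒜 d W) (n : ℤ) : GradedMF 𝒜 d W where
  toGradedSuperModule := P.toGradedSuperModule.shift d n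
  diff := n.negOnePow • P.diff
  homogeneous := (P.homogeneous.units_smul _).shift (by ring)
  diff_mul_diff := by
    have : (n.negOnePow • P.diff) * (n.negOnePow • P.diff) = Matrix.scalar P.ι W := by
      rw [smul_mul_smul_comm, Int.units_mul_self, one_smul, P.diff_mul_diff]
    exact this

variable (𝒜 d W) in
/-- The shift functor `[n]`. -/
def shiftFunctor' (n : ℤ) : GradedMF 𝒜 d W ⥤ GradedMF 𝒜 d W where
  obj P := P.shift n
  map {P Q} f := homMk (P := P.shift n) (Q := Q.shift n) (mat (P := P) (Q := Q) f)
    ((homogeneous_mat f).shift (e' := 0) (by ring)) (by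
      have : mat f * (n.negOnePow • P.diff) = (n.negOnePow • Q.diff) * mat f := by
        rw [Matrix.mul_smul, Matrix.smul_mul, comm]
      exact this)
  map_id _ := rfl
  map_comp _ _ := rfl

lemma mat_eqToHom_shift (P : GradedMF 𝒜 d W) {a b : ℤ} (h : a = b) (h' : P.shift a = P.shift b) :
    mat (eqToHom h') = (1 : Matrix P.ι P.ι A) := by
  subst h; rfl

/-- The isomorphism with identity matrix between two factorizations with the same basis elements,
the same parities and degrees and the same structure maps. -/
def idIso {ι : Type} [Fintype ι] [DecidableEq ι] {p p' : ι → ZMod 2} {g g' : ι → ℤ}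
    {D D' : Matrix ι ι A} {h₁ h₂ h₁' h₂'} (hp : p = p') (hg : g = g') (hD : D = D') :
    (⟨⟨ι, p, g⟩, D, h₁, h₂⟩ : GradedMF 𝒜 d W) ≅ ⟨⟨ι, p', g'⟩, D', h₁', h₂'⟩ :=
  isoMk (homMk (1 : Matrix ι ι A) (by subst hp hg; exact .one) (by subst hD; simp))
    (homMk (1 : Matrix ι ι A) (by subst hp hg; exact .one) (by subst hD; simp))
    (Matrix.one_mul (1 : Matrix ι ι A)) (Matrix.one_mul (1 : Matrix ι ι A))

/-- `P[0]` is `P`. -/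
def shiftZero (P : GradedMF 𝒜 d W) : P.shift 0 ≅ P :=
  idIso (by funext i; simp) (by funext i; simp [GradedSuperModule.carry_zero]) (by simp)

/-- `P[m + n]` is `P[m][n]`. -/
def shiftAdd (P : GradedMF 𝒜 d W) (m n : ℤ) : P.shift (m + n) ≅ (P.shift m).shift n :=
  idIso (by funext i; dsimp [shift, GradedSuperModule.shift]; push_cast; ring)
    (by funext i; dsimp [shift, GradedSuperModule.shift]; rw [GradedSuperModule.carry_add]; ring)
    (by
      have : (m + n).negOnePow • P.diff = n.negOnePow • m.negOnePow • P.diff := by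
        rw [smul_smul, add_comm, Int.negOnePow_add]
      exact this)

variable (𝒜 d W) in
/-- The data of the shift functors on matrix factorizations. -/
def shiftMkCore : ShiftMkCore (GradedMF 𝒜 d W) ℤ where
  F n := shiftFunctor' 𝒜 d W n
  zero := NatIso.ofComponents (fun P => P.shiftZero) (fun {P Q} f => hom_ext (by
    have : (1 : Matrix Q.ι Q.ι A) * mat f = mat f * (1 : Matrix P.ι P.ι A) := by simp
    exact this))
  add m n := NatIso.ofComponents (fun P => P.shiftAdd m n) (fun {P Q} f => hom_ext (by
    have : (1 : Matrix Q.ι Q.ι A) * mat f = mat f * (1 : Matrix P.ι P.ι A) := by simp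
    exact this))
  assoc_hom_app a b c P := hom_ext
    ((congrArg (fun M : Matrix P.ι P.ι A => ((1 : Matrix P.ι P.ι A) * 1) * M)
      (mat_eqToHom_shift P (add_assoc a b c) (congrArg P.shift (add_assoc a b c)))).trans
        (Matrix.mul_one _)).symm
  zero_add_hom_app n P := hom_ext
    ((congrArg (fun M : Matrix P.ι P.ι A => (1 : Matrix P.ι P.ι A) * M)
      (mat_eqToHom_shift P (zero_add n) (congrArg P.shift (zero_add n)))).trans
        (Matrix.mul_one _)).symm
  add_zero_hom_app n P := hom_ext
    ((congrArg (fun M : Matrix P.ι P.ι A => (1 : Matrix P.ι P.ι A) * M)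
      (mat_eqToHom_shift P (add_zero n) (congrArg P.shift (add_zero n)))).trans
        (Matrix.mul_one _)).symm

instance : HasShift (GradedMF 𝒜 d W) ℤ := hasShiftMk _ _ (shiftMkCore 𝒜 d W)

lemma shiftFunctor_eq (n : ℤ) : shiftFunctor (GradedMF 𝒜 d W) n = shiftFunctor' 𝒜 d W n := rfl

lemma mat_shift (f : P ⟶ Q) (n : ℤ) :
    mat ((shiftFunctor (GradedMF 𝒜 d W) n).map f) = (mat f : Matrix Q.ι P.ι A) := rfl

instance (n : ℤ) : (shiftFunctor (GradedMF 𝒜 d W) n).Additive where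
  map_add := rfl

lemma mat_shiftFunctorAdd_hom (P : GradedMF 𝒜 d W) (m n : ℤ) :
    mat ((shiftFunctorAdd (GradedMF 𝒜 d W) m n).hom.app P) = (1 : Matrix P.ι P.ι A) := rfl

lemma mat_shiftFunctorAdd_inv (P : GradedMF 𝒜 d W) (m n : ℤ) :
    mat ((shiftFunctorAdd (GradedMF 𝒜 d W) m n).inv.app P) = (1 : Matrix P.ι P.ι A) := rfl

lemma mat_shiftFunctorComm_hom (P : GradedMF 𝒜 d W) (m n : ℤ) :
    mat ((shiftFunctorComm (GradedMF 𝒜 d W) m n).hom.app P) = (1 : Matrix P.ι P.ι A) := by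
  have h : (shiftFunctorComm (GradedMF 𝒜 d W) m n).hom.app P =
      (shiftFunctorAdd (GradedMF 𝒜 d W) m n).inv.app P ≫
        eqToHom (congrArg P.shift (add_comm m n)) ≫
          (shiftFunctorAdd (GradedMF 𝒜 d W) n m).hom.app P := by
    simp only [shiftFunctorComm, shiftFunctorAdd', Iso.trans_hom, Iso.symm_hom, NatTrans.comp_app,
      eqToIso.hom, eqToHom_app]
    rfl
  rw [h]
  exact (congrArg (fun M : Matrix P.ι P.ι A => ((1 : Matrix P.ι P.ι A) * M) * 1)
    (mat_eqToHom_shift P (add_comm m n) (congrArg P.shift (add_comm m n)))).trans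
      ((Matrix.mul_one ((1 : Matrix P.ι P.ι A) * 1)).trans (Matrix.mul_one 1))

/-! ### The homotopy category -/

/-- Homotopy of morphisms: `f⁰ - g⁰ = q¹ h⁰ + h¹ p⁰` and `f¹ - g¹ = q⁰ h¹ + h⁰ p¹` for
homomorphisms of graded modules `h⁰ : P⁰ → Q¹(-d)` and `h¹ : P¹ → Q⁰`. -/
def Homotopic (P Q : GradedMF 𝒜 d W) (f g : P ⟶ Q) : Prop :=
  ∃ h : Matrix Q.ι P.ι A,
    IsHomogeneousOfDegree 𝒜 d P.toGradedSuperModule Q.toGradedSuperModule (-1) h ∧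
      mat f - mat g = Q.diff * h + h * P.diff

variable (𝒜 d W) in
/-- The homotopy relation on the category of matrix factorizations. -/
def homotopyRel : HomRel (GradedMF 𝒜 d W) := fun P Q f g => Homotopic P Q f g

lemma homotopic_refl (f : P ⟶ Q) : Homotopic P Q f f := ⟨0, .zero, by simp⟩

lemma Homotopic.symm {f g : P ⟶ Q} (H : Homotopic P Q f g) : Homotopic P Q g f := by
  obtain ⟨h, hh, e⟩ := H
  refine ⟨-h, hh.neg, ?_⟩
  rw [← neg_sub, e, Matrix.mul_neg, Matrix.neg_mul, neg_add]

lemma Homotopic.add {f₁ f₂ g₁ g₂ : P ⟶ Q} (H : Homotopic P Q f₁ f₂) (H' : Homotopic P Q g₁ g₂) :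
    Homotopic P Q (f₁ + g₁) (f₂ + g₂) := by
  obtain ⟨h, hh, e⟩ := H
  obtain ⟨h', hh', e'⟩ := H'
  refine ⟨h + h', hh.add hh', ?_⟩
  rw [mat_add, mat_add, add_sub_add_comm, e, e', Matrix.mul_add, Matrix.add_mul]
  abel

lemma Homotopic.trans {f g k : P ⟶ Q} (H : Homotopic P Q f g) (H' : Homotopic P Q g k) :
    Homotopic P Q f k := by
  obtain ⟨h, hh, e⟩ := H
  obtain ⟨h', hh', e'⟩ := H'
  refine ⟨h + h', hh.add hh', ?_⟩
  rw [← sub_add_sub_cancel _ (mat g), e, e', Matrix.mul_add, Matrix.add_mul]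
  abel

lemma Homotopic.comp_left (f : P ⟶ Q) {g₁ g₂ : Q ⟶ R} (H : Homotopic Q R g₁ g₂) :
    Homotopic P R (f ≫ g₁) (f ≫ g₂) := by
  obtain ⟨h, hh, e⟩ := H
  refine ⟨h * mat f, by simpa using hh.mul (homogeneous_mat f), ?_⟩
  rw [mat_comp, mat_comp, ← Matrix.sub_mul, e, Matrix.add_mul, Matrix.mul_assoc, Matrix.mul_assoc,
    Matrix.mul_assoc, comm]

lemma Homotopic.comp_right {f₁ f₂ : P ⟶ Q} (g : Q ⟶ R) (H : Homotopic P Q f₁ f₂) :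
    Homotopic P R (f₁ ≫ g) (f₂ ≫ g) := by
  obtain ⟨h, hh, e⟩ := H
  refine ⟨mat g * h, by simpa using (homogeneous_mat g).mul hh, ?_⟩
  rw [mat_comp, mat_comp, ← Matrix.mul_sub, e, Matrix.mul_add, ← Matrix.mul_assoc,
    ← Matrix.mul_assoc, ← Matrix.mul_assoc, comm]

instance : Congruence (homotopyRel 𝒜 d W) where
  equivalence := ⟨homotopic_refl, Homotopic.symm, Homotopic.trans⟩
  comp_left f _ _ h := Homotopic.comp_left f h
  comp_right g h := Homotopic.comp_right g h

instance : (homotopyRel 𝒜 d W).IsCompatibleWithShift ℤ where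
  condition n P Q f g H := by
    obtain ⟨h, hh, e⟩ := H
    refine ⟨n.negOnePow • h, (hh.units_smul _).shift (by ring), ?_⟩
    have : mat f - mat g =
      (n.negOnePow • Q.diff) * (n.negOnePow • h) + (n.negOnePow • h) * (n.negOnePow • P.diff) := by
      simp only [Matrix.smul_mul, Matrix.mul_smul, smul_smul, Int.units_mul_self, one_smul, e]
    exact this

/-! ### Mapping cones -/

/-- The direct sum. -/
def _root_.GradedSuperModule.sum (P Q : GradedSuperModule) : GradedSuperModule where
  ι := P.ι ⊕ Q.ι
  par := Sum.elim P.par Q.par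
  deg := Sum.elim P.deg Q.deg

/-- The mapping cone of `φ : P ⟶ Q`, that is `P[1] ⊕ Q` with the structure map
`(x, y) ↦ (-p x, φ x + q y)`. -/
def cone (φ : P ⟶ Q) : GradedMF 𝒜 d W where
  toGradedSuperModule := (P.toGradedSuperModule.shift d 1).sum Q.toGradedSuperModule
  diff := Matrix.fromBlocks (-P.diff) 0 (mat φ) Q.diff
  homogeneous := by
    rintro (k | k) (i | i)
    · exact P.homogeneous.neg.shift (m := 1) (n := 1) (e := 1) (by ring) k i
    · exact Or.inl rfl
    · exact (homogeneous_mat φ).shift_left (m := 1) (e := 1) (by ring) k i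
    · exact Q.homogeneous k i
  diff_mul_diff := by
    have hP := P.diff_mul_diff
    have hQ := Q.diff_mul_diff
    have : Matrix.fromBlocks (-P.diff) 0 (mat φ) Q.diff *
        Matrix.fromBlocks (-P.diff) 0 (mat φ) Q.diff = Matrix.scalar (P.ι ⊕ Q.ι) W := by
      rw [Matrix.fromBlocks_multiply]
      simp only [Matrix.neg_mul, Matrix.mul_neg, neg_neg, Matrix.zero_mul, Matrix.mul_zero,
        add_zero, zero_add, hP, hQ, comm, neg_add_cancel]
      simp only [Matrix.scalar_apply, Matrix.fromBlocks_diagonal]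
      congr 1
      ext (i | i) <;> rfl
    exact this

/-- The inclusion `Q ⟶ cone φ`. -/
def coneInr (φ : P ⟶ Q) : Q ⟶ cone φ :=
  homMk (Q := cone φ) (Matrix.fromRows (0 : Matrix P.ι Q.ι A) (1 : Matrix Q.ι Q.ι A))
    (by
      rintro (k | k) i
      · exact Or.inl rfl
      · exact IsHomogeneousOfDegree.one (P := Q.toGradedSuperModule) k i)
    (by
      have : Matrix.fromRows (0 : Matrix P.ι Q.ι A) (1 : Matrix Q.ι Q.ι A) * Q.diff =
          Matrix.fromBlocks (-P.diff) 0 (mat φ) Q.diff *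
            Matrix.fromRows (0 : Matrix P.ι Q.ι A) (1 : Matrix Q.ι Q.ι A) := by
        rw [Matrix.fromRows_mul, Matrix.fromBlocks_mul_fromRows]
        simp
      exact this)

/-- The projection `cone φ ⟶ P[1]`. -/
def coneFst (φ : P ⟶ Q) : cone φ ⟶ (shiftFunctor (GradedMF 𝒜 d W) (1 : ℤ)).obj P :=
  homMk (P := cone φ) (Q := P.shift 1)
    (Matrix.fromCols (1 : Matrix P.ι P.ι A) (0 : Matrix P.ι Q.ι A))
    (by
      rintro k (i | i)
      · exact (IsHomogeneousOfDegree.one (P := P.toGradedSuperModule)).shift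
          (m := 1) (n := 1) (e := 0) (by ring) k i
      · exact Or.inl rfl)
    (by
      have : Matrix.fromCols (1 : Matrix P.ι P.ι A) (0 : Matrix P.ι Q.ι A) *
          Matrix.fromBlocks (-P.diff) 0 (mat φ) Q.diff =
          ((1 : ℤ).negOnePow • P.diff) *
            Matrix.fromCols (1 : Matrix P.ι P.ι A) (0 : Matrix P.ι Q.ι A) := by
        rw [Matrix.fromCols_mul_fromBlocks, Matrix.mul_fromCols]
        simp
      exact this)

/-- The triangle `P ⟶ Q ⟶ cone φ ⟶ P[1]`. -/
def coneTriangle (φ : P ⟶ Q) : Pretriangulated.Triangle (GradedMF 𝒜 d W) :=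
  Pretriangulated.Triangle.mk φ (coneInr φ) (coneFst φ)

lemma homotopic_cone_id (P : GradedMF 𝒜 d W) :
    Homotopic (cone (𝟙 P)) (cone (𝟙 P)) (𝟙 _) 0 := by
  refine ⟨Matrix.fromBlocks (0 : Matrix P.ι P.ι A) (1 : Matrix P.ι P.ι A)
    (0 : Matrix P.ι P.ι A) (0 : Matrix P.ι P.ι A), ?_, ?_⟩
  · rintro (k | k) (i | i)
    · exact Or.inl rfl
    · exact (IsHomogeneousOfDegree.one (P := P.toGradedSuperModule)).shift_right
          (n := 1) (e := -1) (by ring) k i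
    · exact Or.inl rfl
    · exact Or.inl rfl
  · have : (1 : Matrix (P.ι ⊕ P.ι) (P.ι ⊕ P.ι) A) - 0 =
      Matrix.fromBlocks (-P.diff) 0 (1 : Matrix P.ι P.ι A) P.diff *
        Matrix.fromBlocks (0 : Matrix P.ι P.ι A) 1 0 0 + Matrix.fromBlocks 0 1 0 0 *
        Matrix.fromBlocks (-P.diff) 0 (1 : Matrix P.ι P.ι A) P.diff := by
      rw [Matrix.fromBlocks_multiply, Matrix.fromBlocks_multiply, Matrix.fromBlocks_add]
      simp
    exact this

/-- Morphisms between mapping cones exist for squares which commute up to homotopy. -/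
lemma exists_coneMap {P' Q' : GradedMF 𝒜 d W} (φ : P ⟶ Q) (φ' : P' ⟶ Q') (a : P ⟶ P') (b : Q ⟶ Q')
    (H : Homotopic P Q' (φ ≫ b) (a ≫ φ')) :
    ∃ c : cone φ ⟶ cone φ', coneInr φ ≫ c = b ≫ coneInr φ' ∧
      coneFst φ ≫ (shiftFunctor (GradedMF 𝒜 d W) (1 : ℤ)).map a = c ≫ coneFst φ' := by
  obtain ⟨h, hh, e⟩ := H
  simp only [mat_comp] at e
  refine ⟨homMk (P := cone φ) (Q := cone φ') (Matrix.fromBlocks (mat a) 0 h (mat b)) ?_ ?_,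
    hom_ext ?_, hom_ext ?_⟩
  · rintro (k | k) (i | i)
    · exact (homogeneous_mat a).shift (m := 1) (n := 1) (e := 0) (by ring) k i
    · exact Or.inl rfl
    · exact hh.shift_left (m := 1) (e := 0) (by ring) k i
    · exact homogeneous_mat b k i
  · have : Matrix.fromBlocks (mat a) 0 h (mat b) *
        Matrix.fromBlocks (-P.diff) 0 (mat φ) Q.diff =
        Matrix.fromBlocks (-P'.diff) 0 (mat φ') Q'.diff *
          Matrix.fromBlocks (mat a) 0 h (mat b) := by
      rw [Matrix.fromBlocks_multiply, Matrix.fromBlocks_multiply]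
      simp only [Matrix.neg_mul, Matrix.mul_neg, Matrix.zero_mul, Matrix.mul_zero,
        add_zero, zero_add, comm]
      congr 1
      rw [sub_eq_iff_eq_add] at e
      rw [e]
      abel
    exact this
  · have : Matrix.fromBlocks (mat a) 0 h (mat b) *
        Matrix.fromRows (0 : Matrix P.ι Q.ι A) (1 : Matrix Q.ι Q.ι A) =
        Matrix.fromRows (0 : Matrix P'.ι Q'.ι A) (1 : Matrix Q'.ι Q'.ι A) * mat b := by
      rw [Matrix.fromBlocks_mul_fromRows, Matrix.fromRows_mul]
      simp
    exact this
  · have : mat a * Matrix.fromCols (1 : Matrix P.ι P.ι A) (0 : Matrix P.ι Q.ι A) =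
        Matrix.fromCols (1 : Matrix P'.ι P'.ι A) (0 : Matrix P'.ι Q'.ι A) *
          Matrix.fromBlocks (mat a) 0 h (mat b) := by
      rw [Matrix.mul_fromCols, Matrix.fromCols_mul_fromBlocks]
      simp
    exact this

section Rotate

variable (φ : P ⟶ Q)

/-- The homotopy equivalence `P[1] ⟶ cone (Q ⟶ cone φ)`. -/
def rotateHom : (shiftFunctor (GradedMF 𝒜 d W) (1 : ℤ)).obj P ⟶ cone (coneInr φ) :=
  homMk (P := P.shift 1) (Q := cone (coneInr φ))
    (Matrix.fromRows (-mat φ) (Matrix.fromRows (1 : Matrix P.ι P.ι A) (0 : Matrix Q.ι P.ι A)))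
    (by
      rintro (k | k | k) i
      · exact (homogeneous_mat φ).neg.shift (m := 1) (n := 1) (e := 0) (by ring) k i
      · exact (IsHomogeneousOfDegree.one (P := P.toGradedSuperModule)).shift
          (m := 1) (n := 1) (e := 0) (by ring) k i
      · exact Or.inl rfl)
    (by
      have : Matrix.fromRows (-mat φ)
            (Matrix.fromRows (1 : Matrix P.ι P.ι A) (0 : Matrix Q.ι P.ι A)) *
            ((1 : ℤ).negOnePow • P.diff) =
          Matrix.fromBlocks (-Q.diff) 0
            (Matrix.fromRows (0 : Matrix P.ι Q.ι A) (1 : Matrix Q.ι Q.ι A))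
            (Matrix.fromBlocks (-P.diff) 0 (mat φ) Q.diff) *
          Matrix.fromRows (-mat φ)
            (Matrix.fromRows (1 : Matrix P.ι P.ι A) (0 : Matrix Q.ι P.ι A)) := by
        simp [Matrix.fromRows_mul, Matrix.fromBlocks_mul_fromRows, comm]
        ext (i | i | i) j <;> simp
      exact this)

/-- A homotopy inverse of `rotateHom`. -/
def rotateInv : cone (coneInr φ) ⟶ (shiftFunctor (GradedMF 𝒜 d W) (1 : ℤ)).obj P :=
  homMk (P := cone (coneInr φ)) (Q := P.shift 1)
    (Matrix.fromCols (0 : Matrix P.ι Q.ι A)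
      (Matrix.fromCols (1 : Matrix P.ι P.ι A) (0 : Matrix P.ι Q.ι A)))
    (by
      rintro k (i | i | i)
      · exact Or.inl rfl
      · exact (IsHomogeneousOfDegree.one (P := P.toGradedSuperModule)).shift
          (m := 1) (n := 1) (e := 0) (by ring) k i
      · exact Or.inl rfl)
    (by
      have : Matrix.fromCols (0 : Matrix P.ι Q.ι A)
            (Matrix.fromCols (1 : Matrix P.ι P.ι A) (0 : Matrix P.ι Q.ι A)) *
          Matrix.fromBlocks (-Q.diff) 0
            (Matrix.fromRows (0 : Matrix P.ι Q.ι A) (1 : Matrix Q.ι Q.ι A))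
            (Matrix.fromBlocks (-P.diff) 0 (mat φ) Q.diff) = ((1 : ℤ).negOnePow • P.diff) *
          Matrix.fromCols (0 : Matrix P.ι Q.ι A)
            (Matrix.fromCols (1 : Matrix P.ι P.ι A) (0 : Matrix P.ι Q.ι A)) := by
        simp [Matrix.mul_fromCols, Matrix.fromCols_mul_fromBlocks, Matrix.fromCols_mul_fromRows]
      exact this)

lemma rotateHom_rotateInv : rotateHom φ ≫ rotateInv φ = 𝟙 _ := hom_ext (by
  have : Matrix.fromCols (0 : Matrix P.ι Q.ι A)
      (Matrix.fromCols (1 : Matrix P.ι P.ι A) (0 : Matrix P.ι Q.ι A)) *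
      Matrix.fromRows (-mat φ)
        (Matrix.fromRows (1 : Matrix P.ι P.ι A) (0 : Matrix Q.ι P.ι A)) = 1 := by
    simp [Matrix.fromCols_mul_fromRows]
  exact this)

lemma rotateInv_rotateHom : Homotopic _ _ (rotateInv φ ≫ rotateHom φ) (𝟙 _) := by
  refine ⟨Matrix.fromBlocks (0 : Matrix Q.ι Q.ι A)
    (Matrix.fromCols (0 : Matrix Q.ι P.ι A) (-1 : Matrix Q.ι Q.ι A))
    (0 : Matrix (P.ι ⊕ Q.ι) Q.ι A) (0 : Matrix (P.ι ⊕ Q.ι) (P.ι ⊕ Q.ι) A), ?_, ?_⟩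
  · rintro (k | k | k) (i | i | i)
    on_goal 3 =>
      exact (IsHomogeneousOfDegree.one (P := Q.toGradedSuperModule)).neg.shift_right
          (n := 1) (e := -1) (by ring) k i
    all_goals exact Or.inl rfl
  · have : Matrix.fromRows (-mat φ)
        (Matrix.fromRows (1 : Matrix P.ι P.ι A) (0 : Matrix Q.ι P.ι A)) *
        Matrix.fromCols (0 : Matrix P.ι Q.ι A)
        (Matrix.fromCols (1 : Matrix P.ι P.ι A) (0 : Matrix P.ι Q.ι A)) - 1 =
        Matrix.fromBlocks (-Q.diff) 0
            (Matrix.fromRows (0 : Matrix P.ι Q.ι A) (1 : Matrix Q.ι Q.ι A))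
            (Matrix.fromBlocks (-P.diff) 0 (mat φ) Q.diff) *
        Matrix.fromBlocks (0 : Matrix Q.ι Q.ι A)
          (Matrix.fromCols (0 : Matrix Q.ι P.ι A) (-1 : Matrix Q.ι Q.ι A))
          (0 : Matrix (P.ι ⊕ Q.ι) Q.ι A) (0 : Matrix (P.ι ⊕ Q.ι) (P.ι ⊕ Q.ι) A) +
        Matrix.fromBlocks (0 : Matrix Q.ι Q.ι A)
          (Matrix.fromCols (0 : Matrix Q.ι P.ι A) (-1 : Matrix Q.ι Q.ι A))
          (0 : Matrix (P.ι ⊕ Q.ι) Q.ι A) (0 : Matrix (P.ι ⊕ Q.ι) (P.ι ⊕ Q.ι) A) *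
        Matrix.fromBlocks (-Q.diff) 0
            (Matrix.fromRows (0 : Matrix P.ι Q.ι A) (1 : Matrix Q.ι Q.ι A))
            (Matrix.fromBlocks (-P.diff) 0 (mat φ) Q.diff) := by
      rw [Matrix.fromBlocks_multiply, Matrix.fromBlocks_multiply, Matrix.fromBlocks_add,
        sub_eq_iff_eq_add]
      simp only [← Matrix.fromBlocks_one, Matrix.fromBlocks_add,
        Matrix.fromCols_mul_fromBlocks, Matrix.fromCols_mul_fromRows, Matrix.mul_fromCols]
      ext (i | i | i) (j | j | j) <;> simp [Matrix.one_apply]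
    exact this

lemma coneFst_rotateHom :
    Homotopic _ _ (coneFst φ ≫ rotateHom φ) (coneInr (coneInr φ)) := by
  refine ⟨Matrix.fromRows (Matrix.fromCols (0 : Matrix Q.ι P.ι A) (-1 : Matrix Q.ι Q.ι A))
    (0 : Matrix (P.ι ⊕ Q.ι) (P.ι ⊕ Q.ι) A), ?_, ?_⟩
  · rintro (k | k | k) (i | i)
    on_goal 2 =>
      exact (IsHomogeneousOfDegree.one (P := Q.toGradedSuperModule)).neg.shift_right
          (n := 1) (e := -1) (by ring) k i
    all_goals exact Or.inl rfl
  · have : Matrix.fromRows (-mat φ)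
        (Matrix.fromRows (1 : Matrix P.ι P.ι A) (0 : Matrix Q.ι P.ι A)) *
        (Matrix.fromCols (1 : Matrix P.ι P.ι A) (0 : Matrix P.ι Q.ι A)) -
        Matrix.fromRows (0 : Matrix Q.ι (P.ι ⊕ Q.ι) A) (1 : Matrix (P.ι ⊕ Q.ι) (P.ι ⊕ Q.ι) A) =
        Matrix.fromBlocks (-Q.diff) 0
            (Matrix.fromRows (0 : Matrix P.ι Q.ι A) (1 : Matrix Q.ι Q.ι A))
            (Matrix.fromBlocks (-P.diff) 0 (mat φ) Q.diff) *
        Matrix.fromRows (Matrix.fromCols (0 : Matrix Q.ι P.ι A) (-1 : Matrix Q.ι Q.ι A))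
          (0 : Matrix (P.ι ⊕ Q.ι) (P.ι ⊕ Q.ι) A) +
        Matrix.fromRows (Matrix.fromCols (0 : Matrix Q.ι P.ι A) (-1 : Matrix Q.ι Q.ι A))
          (0 : Matrix (P.ι ⊕ Q.ι) (P.ι ⊕ Q.ι) A) *
            (Matrix.fromBlocks (-P.diff) 0 (mat φ) Q.diff) := by
      simp only [← Matrix.fromBlocks_one, Matrix.fromCols_mul_fromBlocks,
        Matrix.fromBlocks_mul_fromRows, Matrix.mul_fromCols, Matrix.fromRows_mul]
      ext (i | i | i) (j | j) <;> simp [Matrix.one_apply]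
    exact this

lemma rotateHom_coneFst : rotateHom φ ≫ coneFst (coneInr φ) =
    -(shiftFunctor (GradedMF 𝒜 d W) (1 : ℤ)).map φ := hom_ext (by
  have : Matrix.fromCols (1 : Matrix Q.ι Q.ι A) (0 : Matrix Q.ι (P.ι ⊕ Q.ι) A) *
      Matrix.fromRows (-mat φ)
        (Matrix.fromRows (1 : Matrix P.ι P.ι A) (0 : Matrix Q.ι P.ι A)) = -mat φ := by
    simp [Matrix.fromCols_mul_fromRows]
  exact this)

end Rotate

section Shift

variable (φ : P ⟶ Q) (n : ℤ)

/-- The isomorphism `(cone φ)[n] ≅ cone (φ[n])`. -/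
def coneShiftIso : (shiftFunctor (GradedMF 𝒜 d W) n).obj (cone φ) ≅
    cone ((shiftFunctor (GradedMF 𝒜 d W) n).map φ) :=
  isoMk
    (homMk (P := (cone φ).shift n) (Q := cone ((shiftFunctor (GradedMF 𝒜 d W) n).map φ))
      (Matrix.fromBlocks (n.negOnePow • (1 : Matrix P.ι P.ι A)) 0 0 (1 : Matrix Q.ι Q.ι A))
      (by
        rintro (k | k) (i | i)
        · exact ((((IsHomogeneousOfDegree.one (P := P.toGradedSuperModule)).units_smul
            n.negOnePow).shift (m := 1) (n := n) (e := 1 - n) (by ring)).shift (m := n)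
              (n := 1) (e := 0) (by ring)) k i
        · exact Or.inl rfl
        · exact Or.inl rfl
        · exact (IsHomogeneousOfDegree.one (P := Q.toGradedSuperModule)).shift (m := n)
              (n := n) (e := 0) (by ring) k i)
      (by
        have : Matrix.fromBlocks (n.negOnePow • (1 : Matrix P.ι P.ι A)) 0 0 (1 : Matrix Q.ι Q.ι A) *
            (n.negOnePow • Matrix.fromBlocks (-P.diff) 0 (mat φ) Q.diff) =
            Matrix.fromBlocks (-(n.negOnePow • P.diff)) 0 (mat φ) (n.negOnePow • Q.diff) *
              Matrix.fromBlocks (n.negOnePow • (1 : Matrix P.ι P.ι A)) 0 0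
                (1 : Matrix Q.ι Q.ι A) := by
          rw [Matrix.fromBlocks_smul, Matrix.fromBlocks_multiply, Matrix.fromBlocks_multiply]
          simp
        exact this))
    (homMk (Q := (cone φ).shift n) (P := cone ((shiftFunctor (GradedMF 𝒜 d W) n).map φ))
      (Matrix.fromBlocks (n.negOnePow • (1 : Matrix P.ι P.ι A)) 0 0 (1 : Matrix Q.ι Q.ι A))
      (by
        rintro (k | k) (i | i)
        · exact ((((IsHomogeneousOfDegree.one (P := P.toGradedSuperModule)).units_smul
            n.negOnePow).shift (m := n) (n := 1) (e := n - 1) (by ring)).shift (m := 1)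
              (n := n) (e := 0) (by ring)) k i
        · exact Or.inl rfl
        · exact Or.inl rfl
        · exact (IsHomogeneousOfDegree.one (P := Q.toGradedSuperModule)).shift (m := n)
              (n := n) (e := 0) (by ring) k i)
      (by
        have : Matrix.fromBlocks (n.negOnePow • (1 : Matrix P.ι P.ι A)) 0 0 (1 : Matrix Q.ι Q.ι A) *
            Matrix.fromBlocks (-(n.negOnePow • P.diff)) 0 (mat φ) (n.negOnePow • Q.diff) =
            (n.negOnePow • Matrix.fromBlocks (-P.diff) 0 (mat φ) Q.diff) *
              Matrix.fromBlocks (n.negOnePow • (1 : Matrix P.ι P.ι A)) 0 0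
                (1 : Matrix Q.ι Q.ι A) := by
          rw [Matrix.fromBlocks_smul, Matrix.fromBlocks_multiply, Matrix.fromBlocks_multiply]
          simp [smul_smul]
        exact this))
    (by
      have : Matrix.fromBlocks (n.negOnePow • (1 : Matrix P.ι P.ι A)) 0 0 (1 : Matrix Q.ι Q.ι A) *
          Matrix.fromBlocks (n.negOnePow • (1 : Matrix P.ι P.ι A)) 0 0 (1 : Matrix Q.ι Q.ι A) =
            1 := by
        rw [Matrix.fromBlocks_multiply]
        simp [smul_smul]
      exact this)
    (by
      have : Matrix.fromBlocks (n.negOnePow • (1 : Matrix P.ι P.ι A)) 0 0 (1 : Matrix Q.ι Q.ι A) *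
          Matrix.fromBlocks (n.negOnePow • (1 : Matrix P.ι P.ι A)) 0 0 (1 : Matrix Q.ι Q.ι A) =
            1 := by
        rw [Matrix.fromBlocks_multiply]
        simp [smul_smul]
      exact this)

/-- The shift of a cone triangle, with the signs `(-1)ⁿ`, is a cone triangle. -/
noncomputable def coneTriangleShiftIso :
    (Pretriangulated.Triangle.shiftFunctor (GradedMF 𝒜 d W) n).obj (coneTriangle φ) ≅
      coneTriangle ((shiftFunctor (GradedMF 𝒜 d W) n).map φ) := by
  refine Pretriangulated.Triangle.isoMk _ _ (Iso.refl _) (n.negOnePow • Iso.refl _)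
    (coneShiftIso φ n) ?_ ?_ ?_
  · have h : (n.negOnePow • (1 : Matrix Q.ι Q.ι A)) * (n.negOnePow • mat φ) =
        mat φ * (1 : Matrix P.ι P.ι A) := by
      simp [smul_smul]
    exact hom_ext ((congrArg₂ (fun (M : Matrix Q.ι Q.ι A) (N : Matrix Q.ι P.ι A) => M * N)
      (mat_units_smul n.negOnePow (𝟙 ((shiftFunctor (GradedMF 𝒜 d W) n).obj Q)))
      (mat_units_smul n.negOnePow ((shiftFunctor (GradedMF 𝒜 d W) n).map φ))).trans h)
  · have h : Matrix.fromBlocks (n.negOnePow • (1 : Matrix P.ι P.ι A)) 0 0 (1 : Matrix Q.ι Q.ι A) *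
          (n.negOnePow • Matrix.fromRows (0 : Matrix P.ι Q.ι A) (1 : Matrix Q.ι Q.ι A)) =
        Matrix.fromRows (0 : Matrix P.ι Q.ι A) (1 : Matrix Q.ι Q.ι A) *
          (n.negOnePow • (1 : Matrix Q.ι Q.ι A)) := by
      rw [Matrix.mul_smul, Matrix.mul_smul, Matrix.fromBlocks_mul_fromRows, Matrix.fromRows_mul]
      simp
    exact hom_ext ((congrArg (fun N : Matrix (P.ι ⊕ Q.ι) Q.ι A => Matrix.fromBlocks
      (n.negOnePow • (1 : Matrix P.ι P.ι A)) 0 0 (1 : Matrix Q.ι Q.ι A) * N)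
      (mat_units_smul n.negOnePow ((shiftFunctor (GradedMF 𝒜 d W) n).map (coneInr φ)))).trans
      (h.trans (congrArg (fun N : Matrix Q.ι Q.ι A =>
        Matrix.fromRows (0 : Matrix P.ι Q.ι A) (1 : Matrix Q.ι Q.ι A) * N)
        (mat_units_smul n.negOnePow (𝟙 ((shiftFunctor (GradedMF 𝒜 d W) n).obj Q)))).symm))
  · have h : (1 : Matrix P.ι P.ι A) * (n.negOnePow • ((1 : Matrix P.ι P.ι A) *
        Matrix.fromCols (1 : Matrix P.ι P.ι A) (0 : Matrix P.ι Q.ι A))) =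
        Matrix.fromCols (1 : Matrix P.ι P.ι A) (0 : Matrix P.ι Q.ι A) *
        Matrix.fromBlocks (n.negOnePow • (1 : Matrix P.ι P.ι A)) 0 0 (1 : Matrix Q.ι Q.ι A) := by
      rw [Matrix.fromCols_mul_fromBlocks]
      ext i (j | j) <;> simp
    refine hom_ext (Eq.trans ?_ h)
    refine congrArg (fun N : Matrix P.ι (P.ι ⊕ Q.ι) A => (1 : Matrix P.ι P.ι A) * N) ?_
    refine (mat_units_smul n.negOnePow ((shiftFunctor (GradedMF 𝒜 d W) n).map (coneFst φ) ≫
      (shiftFunctorComm (GradedMF 𝒜 d W) 1 n).hom.app P)).trans ?_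
    exact congrArg (fun N : Matrix P.ι P.ι A => n.negOnePow • (N *
      Matrix.fromCols (1 : Matrix P.ι P.ι A) (0 : Matrix P.ι Q.ι A)))
      (mat_shiftFunctorComm_hom P 1 n)

end Shift

end GradedMF

open GradedMF

variable (𝒜 : ℤ → Submodule ℂ A) [SetLike.GradedMonoid 𝒜] (d : ℤ) (W : A)

/-- The homotopy category `HMF^gr(W)` of graded matrix factorizations of `W`. -/
abbrev HMF : Type 1 := Quotient (homotopyRel 𝒜 d W)

namespace HMF

instance : Preadditive (HMF 𝒜 d W) :=
  Quotient.preadditive _ (fun _ _ _ _ _ _ h h' => Homotopic.add h h')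

/-- The canonical functor to the homotopy category. -/
abbrev quot : GradedMF 𝒜 d W ⥤ HMF 𝒜 d W := Quotient.functor _

variable {𝒜 d W}

instance : (quot 𝒜 d W).Additive := ⟨rfl⟩

lemma quot_map_eq {P Q : GradedMF 𝒜 d W} {f g : P ⟶ Q} (h : Homotopic P Q f g) :
    (quot 𝒜 d W).map f = (quot 𝒜 d W).map g := CategoryTheory.Quotient.sound _ h

lemma homotopic_of_eq {P Q : GradedMF 𝒜 d W} {f g : P ⟶ Q}
    (h : (quot 𝒜 d W).map f = (quot 𝒜 d W).map g) : Homotopic P Q f g :=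
  (Quotient.functor_map_eq_iff (homotopyRel 𝒜 d W) f g).1 h

lemma quot_map_surjective {P Q : GradedMF 𝒜 d W} (f : (quot 𝒜 d W).obj P ⟶ (quot 𝒜 d W).obj Q) :
    ∃ g, (quot 𝒜 d W).map g = f := (quot 𝒜 d W).map_surjective f

noncomputable instance : (quot 𝒜 d W).CommShift ℤ :=
  Quotient.functor_commShift (homotopyRel 𝒜 d W) ℤ

instance (n : ℤ) : (shiftFunctor (HMF 𝒜 d W) n).Additive := by
  have : ((quot 𝒜 d W ⋙ shiftFunctor _ n)).Additive :=
    Functor.additive_of_iso ((quot 𝒜 d W).commShiftIso n)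
  exact Functor.additive_of_full_essSurj_comp (quot 𝒜 d W) _

lemma isZero_quot_obj {P : GradedMF 𝒜 d W} (h : Homotopic P P (𝟙 P) 0) :
    IsZero ((quot 𝒜 d W).obj P) := by
  rw [IsZero.iff_id_eq_zero, ← CategoryTheory.Functor.map_id, quot_map_eq h, Functor.map_zero]

/-- The zero matrix factorization. -/
def zeroMF : GradedMF 𝒜 d W where
  ι := Empty
  par := Empty.elim
  deg := Empty.elim
  diff := 0
  homogeneous := .zero
  diff_mul_diff := by ext i; exact i.elim

instance : HasZeroObject (HMF 𝒜 d W) :=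
  ⟨(quot 𝒜 d W).obj zeroMF, isZero_quot_obj ⟨0, .zero, by ext i; exact i.elim⟩⟩

open Pretriangulated

/-- The image in the homotopy category of the triangle `P ⟶ Q ⟶ cone φ ⟶ P[1]`. -/
noncomputable abbrev coneTriangleh {P Q : GradedMF 𝒜 d W} (φ : P ⟶ Q) : Triangle (HMF 𝒜 d W) :=
  (quot 𝒜 d W).mapTriangle.obj (coneTriangle φ)

variable (𝒜 d W) in
/-- A triangle of `HMF` is distinguished if it is isomorphic to the triangle of a mapping cone. -/
def distinguishedTriangles : Set (Triangle (HMF 𝒜 d W)) :=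
  {T | ∃ (P Q : GradedMF 𝒜 d W) (φ : P ⟶ Q), Nonempty (T ≅ coneTriangleh φ)}

lemma isomorphic_distinguished (T₁ : Triangle (HMF 𝒜 d W))
    (hT₁ : T₁ ∈ distinguishedTriangles 𝒜 d W) (T₂ : Triangle (HMF 𝒜 d W))
    (e : T₂ ≅ T₁) : T₂ ∈ distinguishedTriangles 𝒜 d W := by
  obtain ⟨X, Y, f, ⟨e'⟩⟩ := hT₁
  exact ⟨X, Y, f, ⟨e ≪≫ e'⟩⟩

lemma contractible_distinguished (X : HMF 𝒜 d W) :
    Pretriangulated.contractibleTriangle X ∈ distinguishedTriangles 𝒜 d W := by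
  obtain ⟨X⟩ := X
  refine ⟨_, _, 𝟙 X, ⟨?_⟩⟩
  have h : IsZero ((quot 𝒜 d W).obj (cone (𝟙 X))) := isZero_quot_obj (homotopic_cone_id X)
  refine Triangle.isoMk _ _ (Iso.refl _) (Iso.refl _) ((isZero_zero _).iso h) ?_
    (h.eq_of_tgt _ _) ((isZero_zero _).eq_of_src _ _)
  exact congrArg (fun f => 𝟙 _ ≫ f) ((quot 𝒜 d W).map_id X).symm

lemma distinguished_cocone_triangle {X Y : HMF 𝒜 d W} (f : X ⟶ Y) :
    ∃ (Z : HMF 𝒜 d W) (g : Y ⟶ Z) (h : Z ⟶ X⟦(1 : ℤ)⟧),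
      Triangle.mk f g h ∈ distinguishedTriangles 𝒜 d W := by
  obtain ⟨X⟩ := X
  obtain ⟨Y⟩ := Y
  obtain ⟨f, rfl⟩ := quot_map_surjective (P := X) (Q := Y) f
  exact ⟨_, _, _, ⟨_, _, f, ⟨Iso.refl _⟩⟩⟩

/-- The rotation of a cone triangle is a cone triangle. -/
noncomputable def rotateConeTrianglehIso {P Q : GradedMF 𝒜 d W} (φ : P ⟶ Q) :
    (coneTriangleh φ).rotate ≅ coneTriangleh (coneInr φ) := by
  let e : (quot 𝒜 d W).obj (P⟦(1 : ℤ)⟧) ≅ (quot 𝒜 d W).obj (cone (coneInr φ)) :=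
    { hom := (quot 𝒜 d W).map (rotateHom φ)
      inv := (quot 𝒜 d W).map (rotateInv φ)
      hom_inv_id := by rw [← Functor.map_comp, rotateHom_rotateInv, CategoryTheory.Functor.map_id]
      inv_hom_id := by
        rw [← Functor.map_comp, quot_map_eq (rotateInv_rotateHom φ),
          CategoryTheory.Functor.map_id] }
  refine Triangle.isoMk _ _ (Iso.refl _) (Iso.refl _)
    (((quot 𝒜 d W).commShiftIso (1 : ℤ)).symm.app P ≪≫ e) ?_ ?_ ?_
  · exact (Category.comp_id _).trans (Category.id_comp _).symm
  · have h : ((quot 𝒜 d W).map (coneFst φ) ≫ ((quot 𝒜 d W).commShiftIso (1 : ℤ)).hom.app P) ≫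
        ((quot 𝒜 d W).commShiftIso (1 : ℤ)).inv.app P ≫ (quot 𝒜 d W).map (rotateHom φ) =
        𝟙 _ ≫ (quot 𝒜 d W).map (coneInr (coneInr φ)) := by
      rw [Category.assoc, Iso.hom_inv_id_app_assoc, ← Functor.map_comp,
        quot_map_eq (coneFst_rotateHom φ), Category.id_comp]
    exact h
  · have h : (-(((quot 𝒜 d W).map φ)⟦(1 : ℤ)⟧')) ≫ (𝟙 ((quot 𝒜 d W).obj Q))⟦(1 : ℤ)⟧' =
        (((quot 𝒜 d W).commShiftIso (1 : ℤ)).inv.app P ≫ (quot 𝒜 d W).map (rotateHom φ)) ≫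
        (quot 𝒜 d W).map (coneFst (coneInr φ)) ≫
          ((quot 𝒜 d W).commShiftIso (1 : ℤ)).hom.app Q := by
      rw [CategoryTheory.Functor.map_id, Category.comp_id, Category.assoc,
        ← Functor.map_comp_assoc, rotateHom_coneFst, Functor.map_neg, Preadditive.neg_comp,
        Functor.commShiftIso_hom_naturality, Preadditive.comp_neg, Iso.inv_hom_id_app_assoc]
    exact h

lemma rotate_distinguished_triangle' (T : Triangle (HMF 𝒜 d W))
    (hT : T ∈ distinguishedTriangles 𝒜 d W) : T.rotate ∈ distinguishedTriangles 𝒜 d W := by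
  obtain ⟨K, L, φ, ⟨e⟩⟩ := hT
  exact ⟨_, _, _, ⟨(rotate _).mapIso e ≪≫ rotateConeTrianglehIso φ⟩⟩

lemma shift_distinguished_triangle (T : Triangle (HMF 𝒜 d W))
    (hT : T ∈ distinguishedTriangles 𝒜 d W) (n : ℤ) :
      (Triangle.shiftFunctor _ n).obj T ∈ distinguishedTriangles 𝒜 d W := by
  obtain ⟨K, L, φ, ⟨e⟩⟩ := hT
  exact ⟨_, _, _, ⟨Functor.mapIso _ e ≪≫ ((quot 𝒜 d W).mapTriangleCommShiftIso n).symm.app _ ≪≫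
    (quot 𝒜 d W).mapTriangle.mapIso (coneTriangleShiftIso φ n)⟩⟩

lemma invRotate_distinguished_triangle' (T : Triangle (HMF 𝒜 d W))
    (hT : T ∈ distinguishedTriangles 𝒜 d W) : T.invRotate ∈ distinguishedTriangles 𝒜 d W :=
  isomorphic_distinguished _
    (shift_distinguished_triangle _ (rotate_distinguished_triangle' _
      (rotate_distinguished_triangle' _ hT)) _) _
    ((invRotateIsoRotateRotateShiftFunctorNegOne _).app T)

lemma rotate_distinguished_triangle (T : Triangle (HMF 𝒜 d W)) :
    T ∈ distinguishedTriangles 𝒜 d W ↔ T.rotate ∈ distinguishedTriangles 𝒜 d W :=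
  ⟨rotate_distinguished_triangle' T, fun hT =>
    isomorphic_distinguished _ (invRotate_distinguished_triangle' T.rotate hT) _
      ((triangleRotation _).unitIso.app T)⟩

lemma exists_coneTrianglehMap {P Q P' Q' : GradedMF 𝒜 d W} (φ : P ⟶ Q) (φ' : P' ⟶ Q')
    (a : (coneTriangleh φ).obj₁ ⟶ (coneTriangleh φ').obj₁)
    (b : (coneTriangleh φ).obj₂ ⟶ (coneTriangleh φ').obj₂)
    (fac : (coneTriangleh φ).mor₁ ≫ b = a ≫ (coneTriangleh φ').mor₁) :
    ∃ c : (coneTriangleh φ).obj₃ ⟶ (coneTriangleh φ').obj₃,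
      (coneTriangleh φ).mor₂ ≫ c = b ≫ (coneTriangleh φ').mor₂ ∧
      (coneTriangleh φ).mor₃ ≫ a⟦(1 : ℤ)⟧' = c ≫ (coneTriangleh φ').mor₃ := by
  obtain ⟨a, rfl⟩ := quot_map_surjective (P := P) (Q := P') a
  obtain ⟨b, rfl⟩ := quot_map_surjective (P := Q) (Q := Q') b
  have H : (quot 𝒜 d W).map (φ ≫ b) = (quot 𝒜 d W).map (a ≫ φ') := by
    rw [Functor.map_comp, Functor.map_comp]
    exact fac
  obtain ⟨c, h₂, h₃⟩ := exists_coneMap φ φ' a b (homotopic_of_eq H)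
  refine ⟨(quot 𝒜 d W).map c, ?_, ?_⟩
  · have h : (quot 𝒜 d W).map (coneInr φ) ≫ (quot 𝒜 d W).map c =
        (quot 𝒜 d W).map b ≫ (quot 𝒜 d W).map (coneInr φ') := by
      rw [← Functor.map_comp, h₂, Functor.map_comp]
    exact h
  · have h : ((quot 𝒜 d W).map (coneFst φ) ≫ ((quot 𝒜 d W).commShiftIso (1 : ℤ)).hom.app P) ≫
        ((quot 𝒜 d W).map a)⟦(1 : ℤ)⟧' = (quot 𝒜 d W).map c ≫ (quot 𝒜 d W).map (coneFst φ') ≫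
          ((quot 𝒜 d W).commShiftIso (1 : ℤ)).hom.app P' := by
      rw [← Functor.map_comp_assoc, ← h₃, Category.assoc, Functor.map_comp_assoc,
        Functor.commShiftIso_hom_naturality]
    exact h

lemma complete_distinguished_triangle_morphism (T₁ T₂ : Triangle (HMF 𝒜 d W))
    (hT₁ : T₁ ∈ distinguishedTriangles 𝒜 d W) (hT₂ : T₂ ∈ distinguishedTriangles 𝒜 d W)
    (a : T₁.obj₁ ⟶ T₂.obj₁) (b : T₁.obj₂ ⟶ T₂.obj₂) (fac : T₁.mor₁ ≫ b = a ≫ T₂.mor₁) :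
    ∃ (c : T₁.obj₃ ⟶ T₂.obj₃), T₁.mor₂ ≫ c = b ≫ T₂.mor₂ ∧
      T₁.mor₃ ≫ a⟦(1 : ℤ)⟧' = c ≫ T₂.mor₃ := by
  obtain ⟨P, Q, φ, ⟨e⟩⟩ := hT₁
  obtain ⟨P', Q', φ', ⟨e'⟩⟩ := hT₂
  obtain ⟨c, h₂, h₃⟩ := exists_coneTrianglehMap φ φ' (e.inv.hom₁ ≫ a ≫ e'.hom.hom₁)
    (e.inv.hom₂ ≫ b ≫ e'.hom.hom₂) (by
      rw [e.inv.comm₁_assoc, reassoc_of% fac, e'.hom.comm₁, Category.assoc, Category.assoc])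
  refine ⟨e.hom.hom₃ ≫ c ≫ e'.inv.hom₃, ?_, ?_⟩
  · rw [e.hom.comm₂_assoc, reassoc_of% h₂, e'.inv.comm₂]
    simp
  · rw [Category.assoc, Category.assoc, ← e'.inv.comm₃, ← reassoc_of% h₃, ← e.hom.comm₃_assoc,
      ← Functor.map_comp, ← Functor.map_comp]
    simp

noncomputable instance : Pretriangulated (HMF 𝒜 d W) where
  distinguishedTriangles := distinguishedTriangles 𝒜 d W
  isomorphic_distinguished := isomorphic_distinguished
  contractible_distinguished := contractible_distinguished
  distinguished_cocone_triangle := distinguished_cocone_triangle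
  rotate_distinguished_triangle := rotate_distinguished_triangle
  complete_distinguished_triangle_morphism := complete_distinguished_triangle_morphism

end HMF

/-! ### The grade shift -/

namespace GradedMF

variable {𝒜 d W} {P Q : GradedMF 𝒜 d W}

/-- The factorization `P(r)`, in which the summands `A(k)` are replaced by `A(k + r)`. -/
def twist (P : GradedMF 𝒜 d W) (r : ℤ) : GradedMF 𝒜 d W where
  ι := P.ι
  par := P.par
  deg i := P.deg i + r
  diff := P.diff
  homogeneous := P.homogeneous.twist r
  diff_mul_diff := P.diff_mul_diff

variable (𝒜 d W) in
/-- The functor `P ↦ P(r)` on matrix factorizations. -/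
def twistFunctor (r : ℤ) : GradedMF 𝒜 d W ⥤ GradedMF 𝒜 d W where
  obj P := P.twist r
  map {P Q} f := homMk (P := P.twist r) (Q := Q.twist r) (mat (P := P) (Q := Q) f)
    ((homogeneous_mat f).twist r) (comm f)
  map_id _ := rfl
  map_comp _ _ := rfl

/-- `P(r)(s)` is `P` if `r + s = 0`. -/
def twistTwistIso (P : GradedMF 𝒜 d W) {r s : ℤ} (h : r + s = 0) : (P.twist r).twist s ≅ P :=
  idIso rfl (by
    funext i
    change P.deg i + r + s = P.deg i
    omega) rfl

variable (𝒜 d W) in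
/-- `P(r)(s)` is `P` if `r + s = 0`, as an isomorphism of functors. -/
def twistFunctorCompIso {r s : ℤ} (h : r + s = 0) :
    twistFunctor 𝒜 d W r ⋙ twistFunctor 𝒜 d W s ≅ 𝟭 _ :=
  NatIso.ofComponents (fun P => P.twistTwistIso h) (fun {P Q} f => hom_ext (by
    have : (1 : Matrix Q.ι Q.ι A) * mat f = mat f * (1 : Matrix P.ι P.ι A) := by simp
    exact this))

end GradedMF

namespace HMF

/-- The functor `P ↦ P(r)` on the homotopy category. -/
def twistFunctor (r : ℤ) : HMF 𝒜 d W ⥤ HMF 𝒜 d W :=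
  CategoryTheory.Quotient.lift _ (GradedMF.twistFunctor 𝒜 d W r ⋙ quot 𝒜 d W)
    (fun P Q f g H => by
      obtain ⟨h, hh, e⟩ := H
      exact quot_map_eq ⟨h, hh.twist r, e⟩)

/-- `P(r)(s)` is `P` if `r + s = 0`. -/
def twistFunctorCompIso {r s : ℤ} (h : r + s = 0) :
    twistFunctor 𝒜 d W r ⋙ twistFunctor 𝒜 d W s ≅ 𝟭 _ :=
  CategoryTheory.Quotient.natIsoLift _
    (Functor.isoWhiskerRight (GradedMF.twistFunctorCompIso 𝒜 d W h) (quot 𝒜 d W))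

/-- The autoequivalence `τ` of `HMF^gr(W)` induced by the grade shift `P ↦ P(1)`; its inverse is
`P ↦ P(-1)`. -/
def gradeShift : HMF 𝒜 d W ≌ HMF 𝒜 d W :=
  CategoryTheory.Equivalence.mk (twistFunctor 𝒜 d W 1) (twistFunctor 𝒜 d W (-1))
    (twistFunctorCompIso 𝒜 d W (by norm_num)).symm (twistFunctorCompIso 𝒜 d W (by norm_num))

end HMF

end MatrixFactorizations

/-! ### Stability conditions -/

section Stability

variable (C : Type*) [Category* C] [Preadditive C] [HasZeroObject C] [HasShift C ℤ]
  [∀ n : ℤ, (shiftFunctor C n).Additive] [Pretriangulated C]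

open Pretriangulated

/-- The Grothendieck group `K(C)` of a triangulated category. -/
def TriangulatedK0 : Type _ :=
  FreeAbelianGroup C ⧸ AddSubgroup.closure {x : FreeAbelianGroup C | ∃ T ∈ distTriang C,
    x = FreeAbelianGroup.of T.obj₂ - FreeAbelianGroup.of T.obj₁ - FreeAbelianGroup.of T.obj₃}

noncomputable instance : AddCommGroup (TriangulatedK0 C) :=
  inferInstanceAs (AddCommGroup (FreeAbelianGroup C ⧸ AddSubgroup.closure _))

variable {C} in
/-- The class of an object in the Grothendieck group. -/
def TriangulatedK0.mk (E : C) : TriangulatedK0 C :=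
  QuotientAddGroup.mk (FreeAbelianGroup.of E)

/-- A Bridgeland stability condition on a triangulated category: the central charge `Z` and the
full additive subcategories `P φ` of semistable objects of phase `φ`. -/
structure StabilityCondition where
  Z : TriangulatedK0 C →+ ℂ
  P : ℝ → ObjectProperty C
  iso_closed : ∀ φ, (P φ).IsClosedUnderIsomorphisms
  zero_mem : ∀ φ E, IsZero E → P φ E
  biprod_mem : ∀ φ E F, P φ E → P φ F → P φ (E ⊞ F)
  central_charge : ∀ φ E, P φ E → ¬ IsZero E →
    ∃ r : ℝ, 0 < r ∧ Z (.mk E) = r * Complex.exp (Complex.I * Real.pi * φ)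
  shift : ∀ φ, P (φ + 1) = (P φ).map (shiftFunctor C (1 : ℤ))
  hom_eq_zero : ∀ φ₁ φ₂, φ₂ < φ₁ → ∀ E₁ E₂, P φ₁ E₁ → P φ₂ E₂ → ∀ f : E₁ ⟶ E₂, f = 0
  harder_narasimhan : ∀ E : C, ¬ IsZero E → ∃ (N : ℕ) (F : ℕ → C) (φ : ℕ → ℝ),
    IsZero (F 0) ∧ Nonempty (F N ≅ E) ∧ (∀ i j, i < j → j < N → φ j < φ i) ∧
      ∀ i < N, ∃ (G : C) (f : F i ⟶ F (i + 1)) (g : F (i + 1) ⟶ G) (h : G ⟶ (F i)⟦(1 : ℤ)⟧),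
        P (φ i) G ∧ Triangle.mk f g h ∈ distTriang C

namespace StabilityCondition

variable {C}

/-- `σ` is of Gepner type with respect to `(Φ, l)`, that is `Φ_* σ = σ · (l)`, where
`Φ_* (Z, P) = (Z ∘ Φ⁻¹, Φ(P))` and `(Z, P) · (l) = (e^{-iπl} Z, P(· + Re l))`. -/
def IsGepnerType (σ : StabilityCondition C) (Φ : C ≌ C) (l : ℂ) : Prop :=
  (∀ E : C, σ.Z (.mk (Φ.inverse.obj E)) =
    Complex.exp (-(Complex.I * Real.pi * l)) * σ.Z (.mk E)) ∧
  ∀ φ : ℝ, (σ.P φ).map Φ.functor = σ.P (φ + l.re)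

/-- The central charge factors through a homomorphism `v` to a free abelian group of finite rank,
for which the support property holds: the norm of `v(E)` is at most a constant multiple of
`|Z(E)|`, for all semistable objects `E`. -/
def HasSupportProperty (σ : StabilityCondition C) : Prop :=
  ∃ (r : ℕ) (v : TriangulatedK0 C →+ (Fin r → ℤ)) (Z' : (Fin r → ℤ) →+ ℂ),
    σ.Z = Z'.comp v ∧ ∃ c : ℝ, ∀ φ E, σ.P φ E → ∀ i, |(v (.mk E) i : ℝ)| ≤ c * ‖σ.Z (.mk E)‖

end StabilityCondition

end Stability

/-! ### The conjecture on Gepner type stability conditions -/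

open MvPolynomial

/-- The supertrace of `e^{2πi/d}` on `P⁰ ⊕ P¹`, i.e. the sum of the numbers `e^{2πik/d}` over the
summands `A(k)` of `P⁰` minus the sum of these numbers over the summands `A(k)` of `P¹`. -/
noncomputable def GradedMF.str {A : Type} [CommRing A] [Algebra ℂ A] {𝒜 : ℤ → Submodule ℂ A}
    {d : ℤ} {W : A} (P : GradedMF 𝒜 d W) : ℂ :=
  ∑ j, (-1) ^ (P.par j).val * Complex.exp (2 * Real.pi * Complex.I * P.deg j / d)

/-- The hypersurface `W = 0` contains the origin, and is smooth away from the origin. -/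
def IsSmoothAwayFromOrigin {n : ℕ} (W : MvPolynomial (Fin n) ℂ) : Prop :=
  eval 0 W = 0 ∧
    ∀ z : Fin n → ℂ, eval z W = 0 → (∀ i, eval z (pderiv i W) = 0) → z = 0

instance {n : ℕ} (a : Fin n → ℤ) : SetLike.GradedMonoid (weightedHomogeneousSubmodule ℂ a) :=
  WeightedHomogeneousSubmodule.gradedMonoid

/-- The category `HMF^gr(W)` for `W ∈ ℂ[x₁, …, xₙ]` homogeneous of degree `d`, where the degree of
`xᵢ` is `a i`. -/
abbrev PolynomialHMF {n : ℕ} (a : Fin n → ℤ) (d : ℤ) (W : MvPolynomial (Fin n) ℂ) : Type 1 :=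
  HMF (weightedHomogeneousSubmodule ℂ a) d W

/-- The statement that `HMF^gr(W)` has a stability condition of Gepner type with respect to
`(τ, 2/d)` whose central charge is the supertrace of `e^{2πi/d}`. -/
def GepnerConjecture {n : ℕ} (a : Fin n → ℤ) (d : ℤ) (W : MvPolynomial (Fin n) ℂ) : Prop :=
  ∃ σ : StabilityCondition (PolynomialHMF a d W),
    σ.HasSupportProperty ∧
    (∀ P : GradedMF (weightedHomogeneousSubmodule ℂ a) d W,
      σ.Z (.mk ((HMF.quot _ d W).obj P)) = P.str) ∧
    σ.IsGepnerType (HMF.gradeShift _ d W) (2 / d)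

/-! Over `ℂ[x]` with `deg x = a ≠ 0` every nonzero homogeneous polynomial is a monomial, so
divisibility of homogeneous elements is comparison of exponents and elimination works as for Smith
normal form. Take a nonzero entry of `P⁰ → P¹` of least degree and clear its row and column; the
relation `diff² = W` then clears the corresponding row and column of `P¹ → P⁰(d)`
(`exists_conj_clearing`, `block_of_clearing`). By induction every factorization is, in the homotopy
category, a direct sum of factorizations `A(m) → A(n) → A(m + d)` (`exists_iso_biprod`,
`exists_hasHN`).

For such a summand, `e^{2πim/d} - e^{2πin/d} = 2 sin(π(n - m)/d) · e^{iπφ}` with `φ = (m + n)/d -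
1/2` (`str_of_rankOne`). Either one structure map is a unit and the summand is contractible, or `(n
- m)/d` lies strictly between 0 and 1 and the sine is positive (`rankOne_trichotomy`). This dictates
the phase, and the semistable objects of phase `φ` are the direct sums of such summands. The shift
replaces `(m, n)` by `(n, m + d)` and so adds 1 to `φ`; the grade shift adds `2/d`. A morphism to a
smaller phase has two components whose degrees, multiplied by `a`, have negative sum: one of them
vanishes for degree reasons, and commutation with the nonzero structure maps kills the other
(`hom_eq_zero_of_phase_lt`). Harder-Narasimhan filtrations come from sorting the summands by phase
(`HasHN.biprod`).

The central charge descends to the Grothendieck group because it factors through the graded rank,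
which counts basis elements with sign in each degree modulo `d`. Its homotopy invariance is a
supertrace argument: after passing to constant terms, a weight depending on the degree modulo `d`,
with the parity sign, anticommutes with odd maps, so a homotopy contributes trace zero
(`weightedTrace_eq_of_homotopy_equiv`). The graded rank also serves as the lattice in the support
property: on a rank one summand its coordinates are at most 1 in absolute value, the sine takes
finitely many values, and within one phase the values of `|Z|` add without cancellation
(`exists_central_charge`). -/

namespace GradedMF

/-! ### Weighted supertraces and their homotopy invariance. -/

variable {A : Type} [CommRing A] [Algebra ℂ A] {𝒜 : ℤ → Submodule ℂ A} {d : ℤ} {W : A}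

/-- The sign `(-1)^par` of a basis element, weighted by a function of its degree. -/
def weight (χ : ℤ → ℂ) (P : GradedSuperModule) (i : P.ι) : ℂ := (-1) ^ (P.par i).val * χ (P.deg i)

/-- An entry survives `ε` only if it has degree 0. Then the degrees of its source and target agree
modulo `d`, so the values of `χ` agree, and the parities differ by `e`, which produces the sign. -/
lemma weight_mul_eq {χ : ℤ → ℂ} (hχ : ∀ n c, χ (n + d * c) = χ n) {ε : A →+* ℂ}
    (hε : ∀ e, e ≠ 0 → ∀ f ∈ 𝒜 e, ε f = 0) {P Q : GradedSuperModule} {e : ℤ}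
    {M : Matrix Q.ι P.ι A} (hM : IsHomogeneousOfDegree 𝒜 d P Q e M) (k : Q.ι) (i : P.ι) :
    weight χ Q k * ε (M k i) = ((e.negOnePow : ℤ) : ℂ) * (ε (M k i) * weight χ P i) := by
  rcases hM k i with h | ⟨c, hc, h⟩
  · simp [h]
  by_cases h0 : Q.deg k + d * c - P.deg i = 0
  · have hs : ((-1 : ℂ)) ^ (Q.par k).val = ((e.negOnePow : ℤ) : ℂ) * (-1) ^ (P.par i).val := by
      have h1 : e = (Q.par k).val + 2 * c - (P.par i).val := by omega
      rw [h1, Int.negOnePow_sub, Int.negOnePow_add, Int.negOnePow_two_mul, Int.negOnePow_def,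
        Int.negOnePow_def]
      push_cast
      have := pow_mul (-1 : ℂ) 2 (P.par i).val
      rw [mul_comm 2, pow_mul, pow_two] at this
      simp only [zpow_natCast, Units.val_pow_eq_pow_val, Units.val_neg, Units.val_one]
      push_cast
      rw [mul_one, mul_assoc, this]; simp
    have hd : P.deg i = Q.deg k + d * c := by omega
    rw [weight, weight, hs, hd, hχ]
    ring
  · simp [hε _ h0 _ h]

/-- The trace of the matrix `weight` on the module underlying `P`. -/
def weightedTrace (χ : ℤ → ℂ) (P : GradedSuperModule) : ℂ := ∑ i, weight χ P i

lemma diagonal_weight_mul {χ : ℤ → ℂ} (hχ : ∀ n c, χ (n + d * c) = χ n) {ε : A →+* ℂ}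
    (hε : ∀ e, e ≠ 0 → ∀ f ∈ 𝒜 e, ε f = 0) {P Q : GradedSuperModule} {e : ℤ}
    {M : Matrix Q.ι P.ι A} (hM : IsHomogeneousOfDegree 𝒜 d P Q e M) :
    Matrix.diagonal (weight χ Q) * M.map ε =
      ((e.negOnePow : ℤ) : ℂ) • (M.map ε * Matrix.diagonal (weight χ P)) := by
  ext k i
  simpa using weight_mul_eq hχ hε hM k i

variable [SetLike.GradedMonoid 𝒜]

/-- The matrix of `f` is `1 + D h + h D` with `D` and `h` odd. The weight anticommutes with odd
matrices after applying `ε`, so the two homotopy terms have opposite traces by cyclicity. -/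
lemma trace_weight_mul_of_homotopic {χ : ℤ → ℂ} (hχ : ∀ n c, χ (n + d * c) = χ n) {ε : A →+* ℂ}
    (hε : ∀ e, e ≠ 0 → ∀ f ∈ 𝒜 e, ε f = 0) {P : GradedMF 𝒜 d W} {f : P ⟶ P}
    (H : Homotopic P P f (𝟙 P)) :
    (Matrix.diagonal (weight χ P.toGradedSuperModule) * (mat f).map ε).trace =
      weightedTrace χ P.toGradedSuperModule := by
  obtain ⟨h, hh, e⟩ := H
  have hD := diagonal_weight_mul hχ hε P.homogeneous
  have hH := diagonal_weight_mul hχ hε hh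
  simp only [Int.negOnePow_one, Int.negOnePow_neg, Units.val_neg, Units.val_one, Int.cast_neg,
    Int.cast_one, neg_smul, one_smul] at hD hH
  have he : (mat f).map ε = 1 + (P.diff.map ε * h.map ε + h.map ε * P.diff.map ε) := by
    rw [← Matrix.map_mul, ← Matrix.map_mul, ← Matrix.map_add _ (map_add ε), ← e,
      Matrix.map_sub _ (map_sub ε)]
    simp
  rw [he, Matrix.mul_add, Matrix.mul_add, Matrix.trace_add, Matrix.trace_add,
    ← Matrix.mul_assoc, ← Matrix.mul_assoc, hH, Matrix.trace_mul_comm _ (h.map ε),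
    Matrix.neg_mul, Matrix.mul_assoc, Matrix.trace_neg, hD]
  simp [weightedTrace, Matrix.trace]

/-- Homotopy equivalent matrix factorizations have the same weighted traces. -/
lemma weightedTrace_eq_of_homotopy_equiv {χ : ℤ → ℂ} (hχ : ∀ n c, χ (n + d * c) = χ n)
    {ε : A →+* ℂ} (hε : ∀ e, e ≠ 0 → ∀ f ∈ 𝒜 e, ε f = 0) {P Q : GradedMF 𝒜 d W} {f : P ⟶ Q}
    {g : Q ⟶ P} (h₁ : Homotopic P P (f ≫ g) (𝟙 P)) (h₂ : Homotopic Q Q (g ≫ f) (𝟙 Q)) :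
    weightedTrace χ P.toGradedSuperModule = weightedTrace χ Q.toGradedSuperModule := by
  rw [← trace_weight_mul_of_homotopic hχ hε h₁, ← trace_weight_mul_of_homotopic hχ hε h₂]
  -- The weight commutes with the even matrix of `g`, so cyclicity of the trace identifies the
  -- weighted traces of the two composites.
  have hg := diagonal_weight_mul hχ hε (homogeneous_mat g)
  simp only [Int.negOnePow_zero, Units.val_one, Int.cast_one, one_smul] at hg
  rw [mat_comp, mat_comp, Matrix.map_mul, Matrix.map_mul, ← Matrix.mul_assoc, hg, Matrix.mul_assoc,
    Matrix.trace_mul_comm, Matrix.mul_assoc]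

end GradedMF

/-! ### Graded ranks modulo `d`. -/

namespace GradedMF

/-- The class in `ℤ[t]/(t^d - 1)` of a graded super module: the `r`-th coefficient is the
signed number of basis elements of degree `r` modulo `d`. -/
def gradedRank (d : ℤ) (P : GradedSuperModule) : Fin d.natAbs → ℤ :=
  fun r => ∑ j, if d ∣ P.deg j - r then (-1) ^ (P.par j).val else 0

/-- Each coordinate is a weighted trace for the indicator function of a residue class, which is
periodic modulo `d`; this is how homotopy invariance reaches the graded rank. -/
lemma gradedRank_cast (d : ℤ) (P : GradedSuperModule) (r : Fin d.natAbs) :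
    (gradedRank d P r : ℂ) = weightedTrace (fun n => if d ∣ n - r then 1 else 0) P := by
  simp [gradedRank, weightedTrace, weight]

lemma neg_one_pow_val_sub_one (p : ZMod 2) : (-1 : ℤ) ^ (p - 1).val = -(-1) ^ p.val := by
  revert p; decide

/-- The shift changes degrees by multiples of `d` and flips every parity. -/
lemma gradedRank_shift_one (d : ℤ) (P : GradedSuperModule) :
    gradedRank d (P.shift d 1) = -gradedRank d P := by
  ext r
  simp only [gradedRank, GradedSuperModule.shift, Pi.neg_apply, ← Finset.sum_neg_distrib]
  refine Finset.sum_congr rfl fun j _ => ?_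
  have h : d ∣ P.deg j + d * GradedSuperModule.carry (P.par j) 1 - r ↔ d ∣ P.deg j - r := by
    rw [add_sub_right_comm]
    exact dvd_add_left (dvd_mul_right _ _)
  have h' := neg_one_pow_val_sub_one (P.par j)
  simp only [Int.cast_one, h, h']
  split_ifs <;> simp

lemma gradedRank_sum (d : ℤ) (P Q : GradedSuperModule) :
    gradedRank d (P.sum Q) = gradedRank d P + gradedRank d Q := by
  ext r
  exact Fintype.sum_sum_type _

/-- The homomorphism `ℤ[t]/(t^d - 1) → ℂ` with `t ↦ e^{2πi/d}`. -/
noncomputable def evalRootOfUnity (d : ℤ) : (Fin d.natAbs → ℤ) →+ ℂ where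
  toFun w := ∑ r, (w r : ℂ) * Complex.exp (2 * Real.pi * Complex.I * (r : ℕ) / d)
  map_zero' := by simp
  map_add' v w := by simp [add_mul, Finset.sum_add_distrib]

lemma exp_eq_of_dvd_sub {d m n : ℤ} (hd : d ≠ 0) (h : d ∣ m - n) :
    Complex.exp (2 * Real.pi * Complex.I * m / d) =
      Complex.exp (2 * Real.pi * Complex.I * n / d) := by
  obtain ⟨c, hc⟩ := h
  have hm : m = n + d * c := by omega
  have hd' : (d : ℂ) ≠ 0 := by exact_mod_cast hd
  rw [Complex.exp_eq_exp_iff_exists_int]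
  refine ⟨c, ?_⟩
  rw [hm]; push_cast; field_simp

lemma evalRootOfUnity_gradedRank {d : ℤ} (hd : d ≠ 0) {A : Type} [CommRing A] [Algebra ℂ A]
    {𝒜 : ℤ → Submodule ℂ A} {W : A} (P : GradedMF 𝒜 d W) :
    evalRootOfUnity d (gradedRank d P.toGradedSuperModule) = P.str := by
  change ∑ r : Fin d.natAbs, _ = ∑ j, _
  simp only [gradedRank, Int.cast_sum, Finset.sum_mul]
  rw [Finset.sum_comm]
  refine Finset.sum_congr rfl fun j _ => ?_
  -- Each basis element contributes to exactly one coordinate, the residue of its degree. Here `d`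
  -- may be negative, and `%` takes values in `[0, |d|)`.
  have h0 : (0 : ℤ) ≤ P.deg j % d := Int.emod_nonneg _ hd
  have hlt : (P.deg j % d).toNat < d.natAbs := by
    have := Int.emod_lt_abs (P.deg j) hd
    rw [Int.abs_eq_natAbs] at this
    omega
  rw [Finset.sum_eq_single ⟨(P.deg j % d).toNat, hlt⟩]
  · have hdvd : d ∣ P.deg j - ((P.deg j % d).toNat : ℤ) := by
      rw [Int.toNat_of_nonneg h0]
      exact Int.dvd_self_sub_emod
    rw [if_pos hdvd, exp_eq_of_dvd_sub hd hdvd]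
    push_cast
    rfl
  · intro r _ hr
    rw [if_neg]
    · simp
    · intro hdvd
      apply hr
      ext
      have h1 : P.deg j % d = (r : ℤ) % d := Int.emod_eq_emod_iff_emod_sub_eq_zero.2
        (Int.emod_eq_zero_of_dvd hdvd)
      have h2 : ((r : ℕ) : ℤ) % d = r := by
        rw [← Int.emod_abs]
        exact Int.emod_eq_of_lt (by positivity) (by have := r.2; rw [Int.abs_eq_natAbs]; omega)
      simp only
      omega
  · simp

end GradedMF

/-! ### The graded rank on the Grothendieck group. -/

namespace HMF

open GradedMF Pretriangulated

variable {A : Type} [CommRing A] [Algebra ℂ A] {𝒜 : ℤ → Submodule ℂ A} [SetLike.GradedMonoid 𝒜]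
  {d : ℤ} {W : A}

/-- The graded rank of an object of the homotopy category. -/
def gradedRank (E : HMF 𝒜 d W) : Fin d.natAbs → ℤ := GradedMF.gradedRank d E.as.toGradedSuperModule

/-- An isomorphism lifts to a homotopy equivalence of representatives, and the coordinates, viewed
in `ℂ`, are weighted traces. -/
lemma gradedRank_eq_of_iso {ε : A →+* ℂ} (hε : ∀ e, e ≠ 0 → ∀ f ∈ 𝒜 e, ε f = 0)
    {E F : HMF 𝒜 d W} (e : E ≅ F) : gradedRank E = gradedRank F := by
  obtain ⟨P⟩ := E
  obtain ⟨Q⟩ := F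
  obtain ⟨f, hf⟩ := quot_map_surjective (P := P) (Q := Q) e.hom
  obtain ⟨g, hg⟩ := quot_map_surjective (P := Q) (Q := P) e.inv
  have h₁ : Homotopic P P (f ≫ g) (𝟙 P) := homotopic_of_eq (by
    rw [Functor.map_comp, hf, hg, CategoryTheory.Functor.map_id]; exact e.hom_inv_id)
  have h₂ : Homotopic Q Q (g ≫ f) (𝟙 Q) := homotopic_of_eq (by
    rw [Functor.map_comp, hf, hg, CategoryTheory.Functor.map_id]; exact e.inv_hom_id)
  ext r
  have : (GradedMF.gradedRank d P.toGradedSuperModule r : ℂ) =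
      GradedMF.gradedRank d Q.toGradedSuperModule r := by
    rw [gradedRank_cast, gradedRank_cast]
    refine weightedTrace_eq_of_homotopy_equiv (fun n c => ?_) hε h₁ h₂
    have : d ∣ n + d * c - r ↔ d ∣ n - r := by
      rw [add_sub_right_comm]
      exact dvd_add_left (dvd_mul_right _ _)
    simp only [this]
  exact_mod_cast this

/-- Up to isomorphism the third vertex is a mapping cone, whose underlying module is `P[1] ⊕ Q`. -/
lemma gradedRank_of_distTriang {ε : A →+* ℂ} (hε : ∀ e, e ≠ 0 → ∀ f ∈ 𝒜 e, ε f = 0)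
    (T : Triangle (HMF 𝒜 d W)) (hT : T ∈ distTriang (HMF 𝒜 d W)) :
    gradedRank T.obj₂ = gradedRank T.obj₁ + gradedRank T.obj₃ := by
  obtain ⟨P, Q, φ, ⟨e⟩⟩ := hT
  have e₁ : gradedRank T.obj₁ = _ := gradedRank_eq_of_iso hε (Triangle.π₁.mapIso e)
  have e₂ : gradedRank T.obj₂ = _ := gradedRank_eq_of_iso hε (Triangle.π₂.mapIso e)
  have e₃ : gradedRank T.obj₃ = _ := gradedRank_eq_of_iso hε (Triangle.π₃.mapIso e)
  rw [e₁, e₂, e₃]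
  have h : GradedMF.gradedRank d (cone φ).toGradedSuperModule =
      -GradedMF.gradedRank d P.toGradedSuperModule + GradedMF.gradedRank d Q.toGradedSuperModule := by
    rw [← gradedRank_shift_one, ← gradedRank_sum]; rfl
  have h' : GradedMF.gradedRank d Q.toGradedSuperModule = GradedMF.gradedRank d P.toGradedSuperModule +
      GradedMF.gradedRank d (cone φ).toGradedSuperModule := by rw [h]; abel
  exact h'

/-- The graded rank as a homomorphism from the Grothendieck group. -/
def gradedRankHom {ε : A →+* ℂ} (hε : ∀ e, e ≠ 0 → ∀ f ∈ 𝒜 e, ε f = 0) :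
    TriangulatedK0 (HMF 𝒜 d W) →+ (Fin d.natAbs → ℤ) :=
  QuotientAddGroup.lift _ (FreeAbelianGroup.lift gradedRank) (by
    rw [AddSubgroup.closure_le]
    rintro x ⟨T, hT, rfl⟩
    simp [gradedRank_of_distTriang hε T hT])

lemma gradedRankHom_mk {ε : A →+* ℂ} (hε : ∀ e, e ≠ 0 → ∀ f ∈ 𝒜 e, ε f = 0) (E : HMF 𝒜 d W) :
    gradedRankHom hε (.mk E) = gradedRank E :=
  FreeAbelianGroup.lift_apply_of gradedRank E

lemma gradedRank_biprod {ε : A →+* ℂ} (hε : ∀ e, e ≠ 0 → ∀ f ∈ 𝒜 e, ε f = 0) (E F : HMF 𝒜 d W) :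
    gradedRank (E ⊞ F) = gradedRank E + gradedRank F :=
  gradedRank_of_distTriang hε _ (binaryBiproductTriangle_distinguished E F)

lemma gradedRank_of_isZero {ε : A →+* ℂ} (hε : ∀ e, e ≠ 0 → ∀ f ∈ 𝒜 e, ε f = 0) {E : HMF 𝒜 d W}
    (h : IsZero E) : gradedRank E = 0 := by
  have h' := gradedRank_biprod hε E E
  -- Since `E ⊞ E` is isomorphic to `E`, the rank equals its own double.
  rw [gradedRank_eq_of_iso hε ((biprod_isZero_iff E E).2 ⟨h, h⟩ |>.iso h)] at h'
  simpa using h'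

end HMF

/-! ### Homogeneous polynomials in one variable. -/

namespace MvPolynomial

variable {a : ℤ} {e e' : ℤ} {f g : MvPolynomial (Fin 1) ℂ}

/-- The weight of `xⁿ` is `n a`, which determines `n` because `a ≠ 0`, so only one monomial can
occur. -/
lemma exists_eq_C_mul_X_pow_of_mem (ha : a ≠ 0)
    (hf : f ∈ weightedHomogeneousSubmodule ℂ (fun _ : Fin 1 => a) e) (h0 : f ≠ 0) :
    ∃ (n : ℕ) (α : ℂ), α ≠ 0 ∧ f = C α * X 0 ^ n ∧ e = n * a := by
  obtain ⟨m, hm⟩ := ne_zero_iff.1 h0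
  have hw : ∀ m' : Fin 1 →₀ ℕ, Finsupp.weight (fun _ : Fin 1 => a) m' = m' 0 * a := fun m' => by
    simp [Finsupp.weight_apply, Finsupp.sum_fintype]
  have he := hf hm
  rw [hw] at he
  refine ⟨m 0, coeff m f, hm, ?_, he.symm⟩
  ext m'
  have hX : (X 0 ^ m 0 : MvPolynomial (Fin 1) ℂ) = monomial m 1 := by
    rw [X_pow_eq_monomial]
    congr
    ext
    simp
  rw [hX, coeff_C_mul, coeff_monomial]
  split_ifs with h
  · rw [h, mul_one]
  · rw [mul_zero]
    by_contra h'
    have he' := hf h'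
    rw [hw, ← he] at he'
    have : m' 0 = m 0 := by exact_mod_cast mul_right_cancel₀ ha he'
    exact h (Finsupp.ext fun i => by fin_cases i; exact this.symm)

/-- Degrees of nonzero elements are `n a` with `n ≥ 0`. Multiplying by `a` treats both signs of `a`
at once. -/
lemma eq_zero_of_mem_of_mul_neg (ha : a ≠ 0)
    (hf : f ∈ weightedHomogeneousSubmodule ℂ (fun _ : Fin 1 => a) e) (h : a * e < 0) : f = 0 := by
  by_contra h0
  obtain ⟨n, α, -, -, rfl⟩ := exists_eq_C_mul_X_pow_of_mem ha hf h0
  have : a * (n * a) = n * (a * a) := by ring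
  have h1 : 0 ≤ (n : ℤ) * (a * a) := mul_nonneg (by positivity) (mul_self_nonneg a)
  omega

lemma exists_eq_C_of_mem_zero (ha : a ≠ 0)
    (hf : f ∈ weightedHomogeneousSubmodule ℂ (fun _ : Fin 1 => a) 0) (h0 : f ≠ 0) :
    ∃ α : ℂ, α ≠ 0 ∧ f = C α := by
  obtain ⟨n, α, hα, rfl, h⟩ := exists_eq_C_mul_X_pow_of_mem ha hf h0
  have : n = 0 := by
    rcases mul_eq_zero.1 h.symm with h | h
    · exact_mod_cast h
    · exact absurd h ha
  exact ⟨α, hα, by simp [this]⟩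

/-- For monomials divisibility is an inequality of exponents. This is what allows a pivot of least
degree to clear its row and column. -/
lemma exists_mul_eq_of_mem (ha : a ≠ 0)
    (hf : f ∈ weightedHomogeneousSubmodule ℂ (fun _ : Fin 1 => a) e)
    (hg : g ∈ weightedHomogeneousSubmodule ℂ (fun _ : Fin 1 => a) e') (h0 : f ≠ 0)
    (h : g ≠ 0 → f.totalDegree ≤ g.totalDegree) :
    ∃ u ∈ weightedHomogeneousSubmodule ℂ (fun _ : Fin 1 => a) (e' - e), g = f * u := by
  by_cases hg0 : g = 0
  · exact ⟨0, zero_mem _, by simp [hg0]⟩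
  obtain ⟨n, α, hα, rfl, rfl⟩ := exists_eq_C_mul_X_pow_of_mem ha hf h0
  obtain ⟨m, β, hβ, rfl, rfl⟩ := exists_eq_C_mul_X_pow_of_mem ha hg hg0
  have hdeg : ∀ (k : ℕ) (γ : ℂ), γ ≠ 0 →
      (C γ * X 0 ^ k : MvPolynomial (Fin 1) ℂ).totalDegree = k := fun k γ hγ => by
    rw [X_pow_eq_monomial, C_mul_monomial, mul_one, totalDegree_monomial _ hγ]
    simp
  have hnm := h hg0
  rw [hdeg _ _ hα, hdeg _ _ hβ] at hnm
  obtain ⟨k, rfl⟩ := Nat.exists_eq_add_of_le hnm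
  refine ⟨C (α⁻¹ * β) * X 0 ^ k, ?_, ?_⟩
  · have := (isWeightedHomogeneous_C (fun _ : Fin 1 => a) (α⁻¹ * β)).mul
      ((isWeightedHomogeneous_X ℂ (fun _ : Fin 1 => a) 0).pow k)
    rw [mem_weightedHomogeneousSubmodule]
    convert this using 1
    push_cast
    simp
    ring
  · rw [C_mul, pow_add]
    have : C α * C α⁻¹ = (1 : MvPolynomial (Fin 1) ℂ) := by rw [← C_mul, mul_inv_cancel₀ hα, C_1]
    linear_combination (-C β * X 0 ^ n * X 0 ^ k) * this

/-- This makes `constantCoeff` an admissible `ε` in the trace arguments. -/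
lemma constantCoeff_eq_zero_of_mem
    (hf : f ∈ weightedHomogeneousSubmodule ℂ (fun _ : Fin 1 => a) e) (he : e ≠ 0) :
    constantCoeff f = 0 := by
  by_contra h
  have := hf (d := 0) h
  simp at this
  exact he this.symm

end MvPolynomial

/-! ### Direct summands and changes of basis. -/

lemma Fintype.sum_subtype_eq_sum_of_eq_zero {M ι : Type} [AddCommMonoid M] [Fintype ι] (s : ι → Prop) [DecidablePred s] (f : ι → M)
    (h : ∀ z, ¬ s z → f z = 0) : ∑ z : {z // s z}, f z = ∑ z, f z := by
  rw [← Fintype.sum_subtype_add_sum_subtype s f, Finset.sum_eq_zero (s := Finset.univ)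
    (fun z : {z // ¬ s z} => fun _ => h z z.2), add_zero]

namespace GradedMF

variable {A : Type} [CommRing A] [Algebra ℂ A] {𝒜 : ℤ → Submodule ℂ A} {d : ℤ} {W : A}

/-- The restriction of a matrix factorization to a set of basis elements, for block diagonal
structure maps. -/
def restrict (P : GradedMF 𝒜 d W) (s : P.ι → Prop) [DecidablePred s]
    (h : ∀ j q, P.diff j q ≠ 0 → (s j ↔ s q)) : GradedMF 𝒜 d W where
  ι := {j // s j}
  par j := P.par j
  deg j := P.deg j
  diff := P.diff.submatrix Subtype.val Subtype.val
  homogeneous k i := P.homogeneous k i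
  diff_mul_diff := by
    ext x y
    have := congrFun (congrFun P.diff_mul_diff x) y
    rw [Matrix.mul_apply] at this ⊢
    -- Paths leaving the block contribute zero, so squaring the submatrix agrees with restricting
    -- the square.
    have h' := Fintype.sum_subtype_eq_sum_of_eq_zero s (fun z => P.diff x z * P.diff z y) (fun z hz => by
      have h0 : P.diff x z = 0 := by
        by_contra h0
        exact hz ((h _ _ h0).1 x.2)
      rw [h0, zero_mul])
    refine h'.trans (this.trans ?_)
    simp [Matrix.scalar_apply, Matrix.diagonal_apply, Subtype.ext_iff]

variable [SetLike.GradedMonoid 𝒜]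

section restrict

variable (P : GradedMF 𝒜 d W) (s : P.ι → Prop) [DecidablePred s]
    (h : ∀ j q, P.diff j q ≠ 0 → (s j ↔ s q))

/-- The inclusion of a direct summand. -/
def restrictIncl : P.restrict s h ⟶ P :=
  homMk (P := P.restrict s h) ((1 : Matrix P.ι P.ι A).submatrix id Subtype.val)
    (fun k (i : {j // s j}) => IsHomogeneousOfDegree.one (P := P.toGradedSuperModule) k i) (by
      refine Matrix.ext fun x (y : {j // s j}) => ?_
      have h₁ := Fintype.sum_subtype_eq_sum_of_eq_zero s (fun z => (1 : Matrix P.ι P.ι A) x z * P.diff z y)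
        (fun z hz => by
          have h0 : P.diff z y = 0 := by
            by_contra h0
            exact hz ((h _ _ h0).2 y.2)
          rw [h0, mul_zero])
      have h₂ : ∑ z, (1 : Matrix P.ι P.ι A) x z * P.diff z y =
          ∑ z, P.diff x z * (1 : Matrix P.ι P.ι A) z y := by
        rw [← Matrix.mul_apply, ← Matrix.mul_apply, Matrix.one_mul, Matrix.mul_one]
      exact h₁.trans h₂)

/-- The projection to a direct summand. -/
def restrictProj : P ⟶ P.restrict s h :=
  homMk (Q := P.restrict s h) ((1 : Matrix P.ι P.ι A).submatrix Subtype.val id)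
    (fun (k : {j // s j}) i => IsHomogeneousOfDegree.one (P := P.toGradedSuperModule) k i) (by
      refine Matrix.ext fun (x : {j // s j}) y => ?_
      have h₁ := Fintype.sum_subtype_eq_sum_of_eq_zero s (fun z => P.diff x z * (1 : Matrix P.ι P.ι A) z y)
        (fun z hz => by
          have h0 : P.diff x z = 0 := by
            by_contra h0
            exact hz ((h _ _ h0).1 x.2)
          rw [h0, zero_mul])
      have h₂ : ∑ z, (1 : Matrix P.ι P.ι A) x z * P.diff z y =
          ∑ z, P.diff x z * (1 : Matrix P.ι P.ι A) z y := by
        rw [← Matrix.mul_apply, ← Matrix.mul_apply, Matrix.one_mul, Matrix.mul_one]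
      exact h₂.trans h₁.symm)

lemma restrictIncl_restrictProj : P.restrictIncl s h ≫ P.restrictProj s h = 𝟙 _ := hom_ext (by
  have : (1 : Matrix P.ι P.ι A).submatrix (Subtype.val : {j // s j} → P.ι) id *
      (1 : Matrix P.ι P.ι A).submatrix id (Subtype.val : {j // s j} → P.ι) = 1 := by
    rw [← Matrix.submatrix_mul _ _ _ _ _ Function.bijective_id, Matrix.one_mul]
    exact Matrix.submatrix_one _ Subtype.val_injective
  exact this)

lemma restrictIncl_restrictProj_of_disjoint (s' : P.ι → Prop) [DecidablePred s']
    (h' : ∀ j q, P.diff j q ≠ 0 → (s' j ↔ s' q)) (hs : ∀ j, s j → ¬ s' j) :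
    P.restrictIncl s h ≫ P.restrictProj s' h' = 0 := hom_ext (by
  have : (1 : Matrix P.ι P.ι A).submatrix (Subtype.val : {j // s' j} → P.ι) id *
      (1 : Matrix P.ι P.ι A).submatrix id (Subtype.val : {j // s j} → P.ι) = 0 := by
    rw [← Matrix.submatrix_mul _ _ _ _ _ Function.bijective_id, Matrix.one_mul]
    ext x y
    exact Matrix.one_apply_ne fun hxy => hs _ y.2 (hxy ▸ x.2)
  exact this)

lemma restrict_total (h' : ∀ j q, P.diff j q ≠ 0 → (¬ s j ↔ ¬ s q)) :
    P.restrictProj s h ≫ P.restrictIncl s h +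
      P.restrictProj (fun j => ¬ s j) h' ≫ P.restrictIncl (fun j => ¬ s j) h' = 𝟙 P := hom_ext (by
  have : (1 : Matrix P.ι P.ι A).submatrix id (Subtype.val : {j // s j} → P.ι) *
        (1 : Matrix P.ι P.ι A).submatrix (Subtype.val : {j // s j} → P.ι) id +
      (1 : Matrix P.ι P.ι A).submatrix id (Subtype.val : {j // ¬ s j} → P.ι) *
        (1 : Matrix P.ι P.ι A).submatrix (Subtype.val : {j // ¬ s j} → P.ι) id = 1 := by
    rw [← Matrix.mul_one (1 : Matrix P.ι P.ι A)]
    ext x y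
    rw [Matrix.mul_apply, ← Fintype.sum_subtype_add_sum_subtype s]
    simp only [Matrix.mul_one]
    rfl
  exact this)

lemma nonempty_iso_biprod_restrict (h' : ∀ j q, P.diff j q ≠ 0 → (¬ s j ↔ ¬ s q)) :
    Nonempty ((HMF.quot 𝒜 d W).obj P ≅ (HMF.quot 𝒜 d W).obj (P.restrict s h) ⊞
      (HMF.quot 𝒜 d W).obj (P.restrict (fun j => ¬ s j) h')) := by
  let F := HMF.quot 𝒜 d W
  let b : BinaryBicone (F.obj (P.restrict s h)) (F.obj (P.restrict (fun j => ¬ s j) h')) :=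
    { pt := F.obj P
      fst := F.map (P.restrictProj s h)
      snd := F.map (P.restrictProj _ h')
      inl := F.map (P.restrictIncl s h)
      inr := F.map (P.restrictIncl _ h')
      inl_fst := by
        rw [← Functor.map_comp, restrictIncl_restrictProj, CategoryTheory.Functor.map_id]
      inl_snd := by
        rw [← Functor.map_comp, restrictIncl_restrictProj_of_disjoint _ _ _ _ _ (by simp),
          Functor.map_zero]
      inr_fst := by
        rw [← Functor.map_comp, restrictIncl_restrictProj_of_disjoint _ _ _ _ _ (by simp),
          Functor.map_zero]
      inr_snd := by
        rw [← Functor.map_comp, restrictIncl_restrictProj, CategoryTheory.Functor.map_id] }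
  refine ⟨biprod.uniqueUpToIso _ _ (isBinaryBilimitOfTotal b ?_)⟩
  dsimp only [b]
  rw [← Functor.map_comp, ← Functor.map_comp, ← Functor.map_add, restrict_total,
    CategoryTheory.Functor.map_id]

end restrict

/-- The matrix factorization obtained by a homogeneous change of basis. -/
def conj (P : GradedMF 𝒜 d W) (g g' : Matrix P.ι P.ι A)
    (hg : IsHomogeneousOfDegree 𝒜 d P.toGradedSuperModule P.toGradedSuperModule 0 g)
    (hg' : IsHomogeneousOfDegree 𝒜 d P.toGradedSuperModule P.toGradedSuperModule 0 g')
    (h : g' * g = 1) : GradedMF 𝒜 d W where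
  toGradedSuperModule := P.toGradedSuperModule
  diff := g * P.diff * g'
  homogeneous := by simpa using (hg.mul P.homogeneous).mul hg'
  diff_mul_diff := by
    have : g * P.diff * g' * (g * P.diff * g') = g * (P.diff * (g' * g) * P.diff) * g' := by
      simp only [Matrix.mul_assoc]
    rw [this, h, Matrix.mul_one, P.diff_mul_diff, ← (Matrix.scalar_commute W (Commute.all W) g).eq,
      Matrix.mul_assoc, mul_eq_one_comm.1 h, Matrix.mul_one]

/-- A change of basis is an isomorphism. -/
def conjIso (P : GradedMF 𝒜 d W) (g g' : Matrix P.ι P.ι A)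
    (hg : IsHomogeneousOfDegree 𝒜 d P.toGradedSuperModule P.toGradedSuperModule 0 g)
    (hg' : IsHomogeneousOfDegree 𝒜 d P.toGradedSuperModule P.toGradedSuperModule 0 g')
    (h : g' * g = 1) : P ≅ P.conj g g' hg hg' h :=
  isoMk (homMk (Q := P.conj g g' hg hg' h) g hg (by
      change _ = g * P.diff * g' * g
      rw [Matrix.mul_assoc _ g' g, h, Matrix.mul_one]; rfl))
    (homMk (P := P.conj g g' hg hg' h) g' hg' (by
      change g' * (g * P.diff * g') = _
      rw [← Matrix.mul_assoc, ← Matrix.mul_assoc, h, Matrix.one_mul]; rfl)) h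
    (mul_eq_one_comm.1 h)

end GradedMF

/-! ### Splitting off a factorization of rank one. -/

lemma IsHomogeneousOfDegree.mem_of_par {A : Type} [CommRing A] [Algebra ℂ A]
    {𝒜 : ℤ → Submodule ℂ A} {d : ℤ} {P Q : GradedSuperModule} {e : ℤ} {M : Matrix Q.ι P.ι A}
    (hM : IsHomogeneousOfDegree 𝒜 d P Q e M) {k : Q.ι} {i : P.ι} {c : ℤ}
    (hc : ((P.par i).val : ℤ) + e = (Q.par k).val + 2 * c) :
    M k i ∈ 𝒜 (Q.deg k + d * c - P.deg i) := by
  rcases hM k i with h | ⟨c', hc', h⟩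
  · rw [h]; exact zero_mem _
  · obtain rfl : c' = c := by omega
    exact h

lemma ZMod.val_two_eq_zero_or_one (p : ZMod 2) : p.val = 0 ∧ p = 0 ∨ p.val = 1 ∧ p = 1 := by
  revert p; decide

namespace GradedMF

open MvPolynomial

/-- A matrix factorization `A(m) → A(n) → A(m + d)` of phase `φ = (m + n)/d - 1/2`. -/
def IsRankOneOfPhase {A : Type} [CommRing A] [Algebra ℂ A] {𝒜 : ℤ → Submodule ℂ A} {d : ℤ} {W : A}
    (P : GradedMF 𝒜 d W) (φ : ℝ) : Prop :=
  ∃ i k : P.ι, P.par i = 0 ∧ P.par k = 1 ∧ (∀ j, j = i ∨ j = k) ∧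
    φ = (P.deg i + P.deg k : ℝ) / d - 1 / 2

/-- The `j`-th diagonal entry of `diff²` is `W ≠ 0`, so some term of the sum is nonzero. -/
lemma exists_diff_mul_diff_ne_zero {A : Type} [CommRing A] [Algebra ℂ A] {𝒜 : ℤ → Submodule ℂ A}
    {d : ℤ} {W : A} (P : GradedMF 𝒜 d W) (hW : W ≠ 0) (j : P.ι) :
    ∃ z, P.diff j z * P.diff z j ≠ 0 := by
  have h := congrFun (congrFun P.diff_mul_diff j) j
  rw [Matrix.mul_apply] at h
  by_contra! h'
  rw [Finset.sum_eq_zero fun z _ => h' z] at h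
  exact hW (by simpa using h.symm)

lemma par_eq_add_one {A : Type} [CommRing A] [Algebra ℂ A] {𝒜 : ℤ → Submodule ℂ A}
    {d : ℤ} {W : A} (P : GradedMF 𝒜 d W) {k i : P.ι} (h : P.diff k i ≠ 0) :
    P.par i = 0 ∧ P.par k = 1 ∨ P.par i = 1 ∧ P.par k = 0 := by
  obtain ⟨c, hc, -⟩ := (P.homogeneous k i).resolve_left h
  rcases ZMod.val_two_eq_zero_or_one (P.par i) with ⟨h₁, h₁'⟩ | ⟨h₁, h₁'⟩ <;>
  rcases ZMod.val_two_eq_zero_or_one (P.par k) with ⟨h₂, h₂'⟩ | ⟨h₂, h₂'⟩ <;>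
  rw [h₁, h₂] at hc
  · push_cast at hc; omega
  · exact Or.inl ⟨h₁', h₂'⟩
  · exact Or.inr ⟨h₁', h₂'⟩
  · push_cast at hc; omega

variable {a d : ℤ} {W : MvPolynomial (Fin 1) ℂ}

lemma exists_pivot (P : GradedMF (weightedHomogeneousSubmodule ℂ (fun _ : Fin 1 => a)) d W)
    (hW : W ≠ 0) (hP : Nonempty P.ι) :
    ∃ i k, P.par i = 0 ∧ P.par k = 1 ∧ P.diff k i ≠ 0 ∧ ∀ i' k', P.par i' = 0 → P.par k' = 1 →
      P.diff k' i' ≠ 0 → (P.diff k i).totalDegree ≤ (P.diff k' i').totalDegree := by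
  classical
  let S : Finset (P.ι × P.ι) := Finset.univ.filter fun x =>
    P.par x.1 = 0 ∧ P.par x.2 = 1 ∧ P.diff x.2 x.1 ≠ 0
  have hS : S.Nonempty := by
    obtain ⟨j⟩ := hP
    obtain ⟨z, hz⟩ := P.exists_diff_mul_diff_ne_zero hW j
    -- Both entries between `j` and `z` are nonzero; exactly one of them goes from even to odd,
    -- depending on the parity of `j`.
    rcases P.par_eq_add_one (left_ne_zero_of_mul hz) with ⟨h₁, h₂⟩ | ⟨h₁, h₂⟩
    · exact ⟨(z, j), by simpa [S] using ⟨h₁, h₂, left_ne_zero_of_mul hz⟩⟩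
    · exact ⟨(j, z), by simpa [S] using ⟨h₂, h₁, right_ne_zero_of_mul hz⟩⟩
  obtain ⟨⟨i, k⟩, hx, hmin⟩ := S.exists_min_image (fun x => (P.diff x.2 x.1).totalDegree) hS
  have hx' : P.par i = 0 ∧ P.par k = 1 ∧ P.diff k i ≠ 0 := by simpa [S] using hx
  refine ⟨i, k, hx'.1, hx'.2.1, hx'.2.2, fun i' k' h₁ h₂ h₃ => hmin (i', k') ?_⟩
  simpa [S] using ⟨h₁, h₂, h₃⟩

/-- One step of Smith reduction: the pivot divides every even-to-odd entry in its row and column,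
and the quotients are homogeneous of the degrees required of a change of basis. -/
lemma exists_conj_clearing (ha : a ≠ 0)
    (P : GradedMF (weightedHomogeneousSubmodule ℂ (fun _ : Fin 1 => a)) d W) {i k : P.ι}
    (hi : P.par i = 0) (hk : P.par k = 1) (h0 : P.diff k i ≠ 0)
    (hmin : ∀ i' k', P.par i' = 0 → P.par k' = 1 → P.diff k' i' ≠ 0 →
      (P.diff k i).totalDegree ≤ (P.diff k' i').totalDegree) :
    ∃ (g g' : Matrix P.ι P.ι (MvPolynomial (Fin 1) ℂ)) (hg : _) (hg' : _) (h : _),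
      (P.conj g g' hg hg' h).diff k i ≠ 0 ∧ (∀ y, y ≠ i → (P.conj g g' hg hg' h).diff k y = 0) ∧
      ∀ x, x ≠ k → (P.conj g g' hg hg' h).diff x i = 0 := by
  have hmem : ∀ {x y}, P.par y = 0 → P.par x = 1 →
      P.diff x y ∈ weightedHomogeneousSubmodule ℂ (fun _ : Fin 1 => a) (P.deg x - P.deg y) := by
    intro x y hy hx
    have := P.homogeneous.mem_of_par (k := x) (i := y) (c := 0) (by rw [hy, hx]; rfl)
    simpa using this
  have hu : ∀ y, ∃ u, P.par y = 0 →
      u ∈ weightedHomogeneousSubmodule ℂ (fun _ : Fin 1 => a) (P.deg i - P.deg y) ∧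
        P.diff k y = P.diff k i * u := by
    intro y
    by_cases hy : P.par y = 0
    · obtain ⟨u, hu, hu'⟩ := exists_mul_eq_of_mem ha (hmem hi hk) (hmem hy hk) h0 (hmin _ _ hy hk)
      exact ⟨u, fun _ => ⟨by convert hu using 2; ring, hu'⟩⟩
    · exact ⟨0, fun h => absurd h hy⟩
  have hw : ∀ x, ∃ w, P.par x = 1 →
      w ∈ weightedHomogeneousSubmodule ℂ (fun _ : Fin 1 => a) (P.deg x - P.deg k) ∧
        P.diff x i = P.diff k i * w := by
    intro x
    by_cases hx : P.par x = 1
    · obtain ⟨u, hu, hu'⟩ := exists_mul_eq_of_mem ha (hmem hi hk) (hmem hi hx) h0 (hmin _ _ hi hx)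
      exact ⟨u, fun _ => ⟨by convert hu using 2; ring, hu'⟩⟩
    · exact ⟨0, fun h => absurd h hx⟩
  choose u hu using hu
  choose w hw using hw
  have h01 : (0 : ZMod 2) ≠ 1 := by decide
  have hik : i ≠ k := fun h => h01 (by rw [← hi, h, hk])
  -- Conjugation by `1 + N` performs all row and column operations at once. The quotients `u` in row
  -- `i` clear row `k` of the structure matrix from the right; the quotients `-w` in column `k`
  -- clear its column `i` from the left.
  let N : Matrix P.ι P.ι (MvPolynomial (Fin 1) ℂ) := fun x y =>
    if x = i ∧ y ≠ i ∧ P.par y = 0 then u y else if y = k ∧ x ≠ k ∧ P.par x = 1 then -w x else 0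
  have hN : IsHomogeneousOfDegree (weightedHomogeneousSubmodule ℂ (fun _ : Fin 1 => a)) d
      P.toGradedSuperModule P.toGradedSuperModule 0 N := by
    intro x y
    by_cases h₁ : x = i ∧ y ≠ i ∧ P.par y = 0
    · obtain ⟨rfl, hy, hy'⟩ := h₁
      refine Or.inr ⟨0, by rw [hi, hy']; rfl, ?_⟩
      have := (hu y hy').1
      simpa [N, hy, hy'] using this
    by_cases h₂ : y = k ∧ x ≠ k ∧ P.par x = 1
    · obtain ⟨rfl, hx, hx'⟩ := h₂
      refine Or.inr ⟨0, by rw [hk, hx']; rfl, ?_⟩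
      have := neg_mem (hw x hx').1
      simpa only [N, if_neg h₁, hx, hx', ne_eq, not_false_eq_true, and_self, if_true, mul_zero,
        add_zero] using this
    · exact Or.inl (by simp only [N, if_neg h₁, if_neg h₂])
  -- `N` sends even basis elements other than `i` to multiples of `i`, and `k` to a combination of
  -- odd ones other than `k`; it kills everything it hits. So `1 - N` inverts `1 + N`.
  have hNN : N * N = 0 := by
    ext1 x z
    rw [Matrix.mul_apply]
    refine Finset.sum_eq_zero fun y _ => ?_
    dsimp only [N]
    split_ifs with h₁ h₂ h₃ h₄ h₅ h₆
    · exact absurd h₂.1 h₁.2.1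
    · exact absurd (h₁.2.2.symm.trans h₃.2.2) h01
    · exact mul_zero _
    · exact absurd (h₅.1.symm.trans h₄.1) hik
    · exact absurd h₄.1 h₆.2.1
    · exact mul_zero _
    all_goals exact zero_mul _
  -- Since row `k` and column `i` of `N` vanish, the left factor leaves row `k` alone and the right
  -- factor leaves column `i` alone: the two clearings do not interfere and the pivot survives.
  have hNk : ∀ y, N k y = 0 := fun y => by simp [N, hik.symm]
  have hNi : ∀ x, N x i = 0 := fun y => by simp [N, hik]
  have hdiff : ∀ x y, ((1 + N) * P.diff * (1 - N)) x y =
      P.diff x y + (N * P.diff) x y - ((P.diff + N * P.diff) * N) x y := fun x y => by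
    rw [Matrix.add_mul, Matrix.mul_sub, Matrix.one_mul, Matrix.mul_one]
    rfl
  have hNDk : ∀ y, (N * P.diff) k y = 0 := fun y => by simp [Matrix.mul_apply, hNk]
  have hMi : ∀ (M : Matrix P.ι P.ι (MvPolynomial (Fin 1) ℂ)) x, (M * N) x i = 0 := fun M x => by
    simp [Matrix.mul_apply, hNi]
  have hg := (IsHomogeneousOfDegree.one (𝒜 := weightedHomogeneousSubmodule ℂ (fun _ : Fin 1 => a))
    (d := d) (P := P.toGradedSuperModule)).add hN
  have hg' := (IsHomogeneousOfDegree.one (𝒜 := weightedHomogeneousSubmodule ℂ (fun _ : Fin 1 => a))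
    (d := d) (P := P.toGradedSuperModule)).sub hN
  have h : (1 - N) * (1 + N) = 1 := by
    rw [Matrix.sub_mul, Matrix.mul_add, Matrix.mul_add, hNN]
    simp
  refine ⟨1 + N, 1 - N, hg, hg', h, ?_, fun y hy => ?_, fun x hx => ?_⟩
  · change ((1 + N) * P.diff * (1 - N)) k i ≠ 0
    rw [hdiff, hNDk, hMi, add_zero, sub_zero]
    exact h0
  · rcases ZMod.val_two_eq_zero_or_one (P.par y) with ⟨-, hy'⟩ | ⟨-, hy'⟩
    · change ((1 + N) * P.diff * (1 - N)) k y = 0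
      rw [hdiff, hNDk, add_zero, Matrix.mul_apply, Finset.sum_eq_single i]
      · rw [Matrix.add_apply, hNDk, add_zero, (hu y hy').2]
        simp [N, hy, hy']
      · intro z _ hz
        have hyk : y ≠ k := fun h => h01 (by rw [← hy', h, hk])
        simp [N, hz, hyk]
      · simp
    -- For odd `y` the entry vanishes by parity.
    · by_contra hne
      rcases par_eq_add_one _ hne with ⟨h₁, -⟩ | ⟨-, h₂⟩
      · exact h01 (h₁.symm.trans hy')
      · exact h01 (h₂.symm.trans hk)
  · rcases ZMod.val_two_eq_zero_or_one (P.par x) with ⟨-, hx'⟩ | ⟨-, hx'⟩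
    · by_contra hne
      rcases par_eq_add_one _ hne with ⟨-, h₂⟩ | ⟨h₁, -⟩
      · exact h01 (hx'.symm.trans h₂)
      · exact h01 (hi.symm.trans h₁)
    · change ((1 + N) * P.diff * (1 - N)) x i = 0
      rw [hdiff, hMi, sub_zero, Matrix.mul_apply, Finset.sum_eq_single k]
      · have hxi : x ≠ i := fun h => h01 (by rw [← hx', h, hi])
        rw [(hw x hx').2]
        simp only [N, hxi, hx, hx', false_and, if_false, ne_eq, not_false_eq_true, and_self,
          if_true]
        ring
      · intro z _ hz
        have hxi : x ≠ i := fun h => h01 (by rw [← hx', h, hi])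
        simp [N, hz, hxi]
      · simp

/-- Off-diagonal entries of `diff²` vanish. In row `k` and in column `i` only one term of the sum
survives, and it contains the nonzero pivot; cancelling the pivot in the domain shows that row `i`
and column `k` are clear as well. -/
lemma block_of_clearing {A : Type} [CommRing A] [IsDomain A] [Algebra ℂ A] {𝒜 : ℤ → Submodule ℂ A}
    {d : ℤ} {W : A} (P : GradedMF 𝒜 d W) {i k : P.ι} (h0 : P.diff k i ≠ 0)
    (hk : ∀ y, y ≠ i → P.diff k y = 0) (hi : ∀ x, x ≠ k → P.diff x i = 0) (j q : P.ι)
    (h : P.diff j q ≠ 0) : (j = i ∨ j = k) ↔ (q = i ∨ q = k) := by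
  have hsq : ∀ x y, x ≠ y → ∑ z, P.diff x z * P.diff z y = 0 := fun x y hxy => by
    rw [← Matrix.mul_apply, P.diff_mul_diff]
    exact Matrix.diagonal_apply_ne _ hxy
  have h₁ : ∀ y, y ≠ k → P.diff i y = 0 := fun y hy => by
    have := hsq k y hy.symm
    rw [Finset.sum_eq_single i (fun z _ hz => by rw [hk z hz, zero_mul]) (by simp)] at this
    exact (mul_eq_zero.1 this).resolve_left h0
  have h₂ : ∀ x, x ≠ i → P.diff x k = 0 := fun x hx => by
    have := hsq x i hx
    rw [Finset.sum_eq_single k (fun z _ hz => by rw [hi z hz, mul_zero]) (by simp)] at this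
    exact (mul_eq_zero.1 this).resolve_right h0
  constructor
  · rintro (rfl | rfl)
    · by_contra! h'
      exact h (h₁ q h'.2)
    · by_contra! h'
      exact h (hk q h'.1)
  · rintro (rfl | rfl)
    · by_contra! h'
      exact h (hi j h'.2)
    · by_contra! h'
      exact h (h₂ j h'.1)

/-- A nonzero graded matrix factorization over `ℂ[x]` splits off one of rank one. -/
lemma exists_iso_biprod (ha : a ≠ 0) (hW : W ≠ 0)
    (P : GradedMF (weightedHomogeneousSubmodule ℂ (fun _ : Fin 1 => a)) d W)
    (hP : Nonempty P.ι) :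
    ∃ (M Q : GradedMF (weightedHomogeneousSubmodule ℂ (fun _ : Fin 1 => a)) d W) (φ : ℝ),
      M.IsRankOneOfPhase φ ∧ Fintype.card Q.ι < Fintype.card P.ι ∧
      Nonempty ((HMF.quot _ d W).obj P ≅ (HMF.quot _ d W).obj Q ⊞ (HMF.quot _ d W).obj M) := by
  classical
  obtain ⟨i, k, hi, hk, h0, hmin⟩ := P.exists_pivot hW hP
  obtain ⟨g, g', hg, hg', h, h₁, h₂, h₃⟩ := P.exists_conj_clearing ha hi hk h0 hmin
  let R := P.conj g g' hg hg' h
  have hb : ∀ j q : R.ι, R.diff j q ≠ 0 → ((j = i ∨ j = k) ↔ (q = i ∨ q = k)) :=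
    R.block_of_clearing (i := i) (k := k) h₁ h₂ h₃
  obtain ⟨e⟩ := R.nonempty_iso_biprod_restrict (fun j => j = i ∨ j = k) hb
    (fun j q hjq => not_congr (hb j q hjq))
  refine ⟨_, _, _, ⟨(⟨i, Or.inl rfl⟩ : {j // j = i ∨ j = k}),
    (⟨k, Or.inr rfl⟩ : {j // j = i ∨ j = k}), hi, hk, ?_, rfl⟩, ?_,
    ⟨(HMF.quot _ d W).mapIso (P.conjIso g g' hg hg' h) ≪≫ e ≪≫ biprod.braiding _ _⟩⟩
  · rintro ⟨j, rfl | rfl⟩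
    · exact Or.inl rfl
    · exact Or.inr rfl
  -- The complement omits `i`, so the rank drops and induction can proceed.
  · exact Fintype.card_lt_of_injective_of_notMem (β := P.ι) (b := i)
      (Subtype.val : {j : P.ι // ¬ (j = i ∨ j = k)} → P.ι) Subtype.val_injective
      (by rintro ⟨x, hx⟩; exact x.2 (Or.inl hx))

end GradedMF

/-! ### Semistable objects and the two shifts. -/

lemma CategoryTheory.Functor.nonempty_map_biprod_iso {C D : Type*} [Category* C] [Category* D]
    [Preadditive C] [Preadditive D] [HasBinaryBiproducts C] [HasBinaryBiproducts D] (F : C ⥤ D)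
    [F.Additive] (E E' : C) : Nonempty (F.obj (E ⊞ E') ≅ F.obj E ⊞ F.obj E') := by
  have := preservesBinaryBiproducts_of_preservesBiproducts F
  exact ⟨F.mapBiprod E E'⟩

namespace GradedMF

variable {A : Type} [CommRing A] [Algebra ℂ A] {𝒜 : ℤ → Submodule ℂ A} {d : ℤ} {W : A}

/-- The phase depends only on the sum of the two degrees, which grows by `d n` under `[n]`; for odd
`n` the two basis elements exchange parities, which does not affect the sum. -/
lemma IsRankOneOfPhase.shift (hd : d ≠ 0) {P : GradedMF 𝒜 d W} {φ : ℝ}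
    (h : P.IsRankOneOfPhase φ) (n : ℤ) : (P.shift n).IsRankOneOfPhase (φ + n) := by
  obtain ⟨i, k, hi, hk, hP, rfl⟩ := h
  have hd' : (d : ℝ) ≠ 0 := by exact_mod_cast hd
  have h₀ := GradedSuperModule.carry_spec 0 n
  have h₁ := GradedSuperModule.carry_spec 1 n
  -- Add the two instances of `carry_spec`: the new parities are again 0 and 1 in some order, so the
  -- carries sum to `n`.
  have key : GradedSuperModule.carry 0 n + GradedSuperModule.carry 1 n = n ∧
      ((0 : ZMod 2) - n = 0 ∧ (1 : ZMod 2) - n = 1 ∨ (0 : ZMod 2) - n = 1 ∧ (1 : ZMod 2) - n = 0) := by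
    have h01 : ∀ p : ZMod 2, (0 - p = 0 ∧ 1 - p = 1 ∨ 0 - p = 1 ∧ 1 - p = 0) ∧
        (0 - p).val + (1 - p).val = 1 := by decide
    obtain ⟨h2, h3⟩ := h01 n
    refine ⟨?_, h2⟩
    have h4 : (1 : ZMod 2).val = 1 := rfl
    have h5 : (0 : ZMod 2).val = 0 := rfl
    rw [h4] at h₁
    rw [h5] at h₀
    omega
  have hphase : ((P.deg i + P.deg k : ℝ) / d - 1 / 2 + n) =
      (((P.deg i + d * GradedSuperModule.carry (P.par i) n : ℤ) : ℝ) +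
        ((P.deg k + d * GradedSuperModule.carry (P.par k) n : ℤ) : ℝ)) / d - 1 / 2 := by
    rw [hi, hk]
    have : (n : ℝ) = GradedSuperModule.carry 0 n + GradedSuperModule.carry 1 n := by
      exact_mod_cast key.1.symm
    rw [this]
    push_cast
    field_simp
    ring
  rcases key.2 with ⟨h₂, h₃⟩ | ⟨h₂, h₃⟩
  · exact ⟨i, k, (congrArg (· - (n : ZMod 2)) hi).trans h₂, (congrArg (· - (n : ZMod 2)) hk).trans h₃,
      hP, hphase⟩
  · refine ⟨k, i, (congrArg (· - (n : ZMod 2)) hk).trans h₃, (congrArg (· - (n : ZMod 2)) hi).trans h₂,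
      fun j => (hP j).symm, hphase.trans ?_⟩
    rw [add_comm]
    rfl

lemma IsRankOneOfPhase.twist (hd : d ≠ 0) {P : GradedMF 𝒜 d W} {φ : ℝ}
    (h : P.IsRankOneOfPhase φ) (r : ℤ) : (P.twist r).IsRankOneOfPhase (φ + r * (2 / d)) := by
  obtain ⟨i, k, hi, hk, hP, rfl⟩ := h
  have hd' : (d : ℝ) ≠ 0 := by exact_mod_cast hd
  refine ⟨i, k, hi, hk, hP, ?_⟩
  change _ = (((P.deg i + r : ℤ) : ℝ) + ((P.deg k + r : ℤ) : ℝ)) / d - 1 / 2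
  push_cast
  field_simp
  ring

end GradedMF

namespace HMF

open GradedMF Pretriangulated

variable {A : Type} [CommRing A] [Algebra ℂ A] {𝒜 : ℤ → Submodule ℂ A} [SetLike.GradedMonoid 𝒜]
  {d : ℤ} {W : A}

/-- The semistable objects of phase `φ`: the direct sums of matrix factorizations of rank one and
phase `φ`. -/
inductive IsSemistable (𝒜 : ℤ → Submodule ℂ A) [SetLike.GradedMonoid 𝒜] (d : ℤ) (W : A) (φ : ℝ) :
    HMF 𝒜 d W → Prop
  | zero (E : HMF 𝒜 d W) (h : IsZero E) : IsSemistable 𝒜 d W φ E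
  | rankOne (P : GradedMF 𝒜 d W) (h : P.IsRankOneOfPhase φ) :
      IsSemistable 𝒜 d W φ ((quot 𝒜 d W).obj P)
  | biprod (E F : HMF 𝒜 d W) (hE : IsSemistable 𝒜 d W φ E) (hF : IsSemistable 𝒜 d W φ F) :
      IsSemistable 𝒜 d W φ (E ⊞ F)
  | iso (E F : HMF 𝒜 d W) (e : E ≅ F) (hE : IsSemistable 𝒜 d W φ E) : IsSemistable 𝒜 d W φ F

lemma IsSemistable.map {Φ : HMF 𝒜 d W ⥤ HMF 𝒜 d W} [Φ.Additive] {ψ : ℝ}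
    (hΦ : ∀ φ (P : GradedMF 𝒜 d W), P.IsRankOneOfPhase φ →
      IsSemistable 𝒜 d W (φ + ψ) (Φ.obj ((quot 𝒜 d W).obj P))) {φ : ℝ} {E : HMF 𝒜 d W}
    (hE : IsSemistable 𝒜 d W φ E) : IsSemistable 𝒜 d W (φ + ψ) (Φ.obj E) := by
  induction hE with
  | zero E h => exact .zero _ (Φ.map_isZero h)
  | rankOne P h => exact hΦ φ P h
  | biprod E F _ _ hE hF =>
    obtain ⟨e⟩ := Φ.nonempty_map_biprod_iso E F
    exact .iso _ _ e.symm (.biprod _ _ hE hF)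
  | iso E F e _ hE => exact .iso _ _ (Φ.mapIso e) hE

/-- Additivity reduces everything to rank one. A semistable object of phase `φ + ψ` is the image
under `Φ` of its image under the inverse `Ψ`, which lowers phases by `ψ`. -/
lemma isSemistable_map_eq {Φ Ψ : HMF 𝒜 d W ⥤ HMF 𝒜 d W} [Φ.Additive] [Ψ.Additive]
    (e : Ψ ⋙ Φ ≅ 𝟭 _) {ψ : ℝ}
    (hΦ : ∀ φ (P : GradedMF 𝒜 d W), P.IsRankOneOfPhase φ →
      IsSemistable 𝒜 d W (φ + ψ) (Φ.obj ((quot 𝒜 d W).obj P)))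
    (hΨ : ∀ φ (P : GradedMF 𝒜 d W), P.IsRankOneOfPhase φ →
      IsSemistable 𝒜 d W (φ + -ψ) (Ψ.obj ((quot 𝒜 d W).obj P))) (φ : ℝ) :
    ObjectProperty.map (IsSemistable 𝒜 d W φ) Φ = IsSemistable 𝒜 d W (φ + ψ) := by
  ext E
  constructor
  · rintro ⟨F, hF, ⟨e'⟩⟩
    exact .iso _ _ e' (hF.map hΦ)
  · intro hE
    refine ⟨Ψ.obj E, ?_, ⟨e.app E⟩⟩
    have := hE.map hΨ
    rwa [add_neg_cancel_right] at this

instance (r : ℤ) : (twistFunctor 𝒜 d W r).Additive where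
  map_add := by
    rintro ⟨P⟩ ⟨Q⟩ ⟨f⟩ ⟨g⟩
    rfl

lemma isSemistable_map_shift (hd : d ≠ 0) (φ : ℝ) :
    ObjectProperty.map (IsSemistable 𝒜 d W φ) (shiftFunctor (HMF 𝒜 d W) (1 : ℤ)) =
      IsSemistable 𝒜 d W (φ + 1) := by
  have h : ∀ n : ℤ, ∀ φ (P : GradedMF 𝒜 d W), P.IsRankOneOfPhase φ →
      IsSemistable 𝒜 d W (φ + n) ((shiftFunctor (HMF 𝒜 d W) n).obj ((quot 𝒜 d W).obj P)) :=
    fun n φ P hP => .iso _ _ (((quot 𝒜 d W).commShiftIso n).app P)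
      (.rankOne _ (hP.shift hd n))
  exact isSemistable_map_eq (Ψ := shiftFunctor _ (-1 : ℤ))
    (shiftFunctorCompIsoId _ (-1 : ℤ) 1 (by norm_num)) (by simpa using h 1) (by simpa using h (-1)) φ

lemma isSemistable_map_gradeShift (hd : d ≠ 0) (φ : ℝ) :
    ObjectProperty.map (IsSemistable 𝒜 d W φ) (gradeShift 𝒜 d W).functor =
      IsSemistable 𝒜 d W (φ + 2 / d) := by
  have h : ∀ r : ℤ, ∀ φ (P : GradedMF 𝒜 d W), P.IsRankOneOfPhase φ →
      IsSemistable 𝒜 d W (φ + r * (2 / d)) ((twistFunctor 𝒜 d W r).obj ((quot 𝒜 d W).obj P)) :=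
    fun r φ P hP => .rankOne _ (hP.twist hd r)
  exact isSemistable_map_eq (Φ := twistFunctor 𝒜 d W 1) (Ψ := twistFunctor 𝒜 d W (-1))
    (twistFunctorCompIso 𝒜 d W (by norm_num)) (by simpa using h 1) (by simpa using h (-1)) φ

/-! ### Harder-Narasimhan filtrations -/

/-- Direct sums of semistable objects whose phases are greater than `b`, arranged by decreasing
phase. -/
inductive HasHN (𝒜 : ℤ → Submodule ℂ A) [SetLike.GradedMonoid 𝒜] (d : ℤ) (W : A) :
    ℝ → HMF 𝒜 d W → Prop
  | zero (b : ℝ) (E : HMF 𝒜 d W) (h : IsZero E) : HasHN 𝒜 d W b E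
  | step (b φ : ℝ) (E G : HMF 𝒜 d W) (hE : HasHN 𝒜 d W φ E) (hG : IsSemistable 𝒜 d W φ G)
      (h : b < φ) : HasHN 𝒜 d W b (E ⊞ G)
  | iso (b : ℝ) (E F : HMF 𝒜 d W) (e : E ≅ F) (hE : HasHN 𝒜 d W b E) : HasHN 𝒜 d W b F

lemma HasHN.mono {b b' : ℝ} {E : HMF 𝒜 d W} (h : HasHN 𝒜 d W b E) (hb : b' ≤ b) :
    HasHN 𝒜 d W b' E := by
  induction h with
  | zero b E h => exact .zero _ _ h
  | step b φ E G hE hG h _ => exact .step _ _ _ _ hE hG (hb.trans_lt h)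
  | iso b E F e _ ih => exact .iso _ _ _ e (ih hb)

/-- Insertion into a list sorted by phase. The outermost summand `G` has the lowest phase: `M` moves
further inside, merges with `G`, or becomes the new outermost summand, according to the comparison
of `ψ` with the phase of `G`. -/
lemma HasHN.biprod {b ψ : ℝ} {E M : HMF 𝒜 d W} (h : HasHN 𝒜 d W b E)
    (hM : IsSemistable 𝒜 d W ψ M) (hb : b < ψ) : HasHN 𝒜 d W b (E ⊞ M) := by
  induction h with
  | zero b E h => exact .step _ _ _ _ (.zero _ _ h) hM hb
  | step b φ E G hE hG h ih =>
    rcases lt_trichotomy φ ψ with hlt | rfl | hlt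
    · exact .iso _ _ _ (biprod.associator E M G ≪≫
          biprod.mapIso (Iso.refl E) (biprod.braiding M G) ≪≫ (biprod.associator E G M).symm)
        (.step _ _ _ _ (ih hlt) hG h)
    · exact .iso _ _ _ (biprod.associator E G M).symm
        (.step _ _ _ _ hE (.biprod _ _ hG hM) h)
    · exact .step _ _ _ _ (.step _ _ _ _ hE hG hlt) hM hb
  | iso b E F e _ ih => exact .iso _ _ _ (biprod.mapIso e (Iso.refl M)) (ih hb)

/-- The bound `b < φ i` is carried through the induction because it makes the phases strictly
decreasing when a new lowest factor is appended. -/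
lemma HasHN.exists_filtration {b : ℝ} {E : HMF 𝒜 d W} (h : HasHN 𝒜 d W b E) :
    ∃ (N : ℕ) (F : ℕ → HMF 𝒜 d W) (φ : ℕ → ℝ),
      IsZero (F 0) ∧ Nonempty (F N ≅ E) ∧ (∀ i j, i < j → j < N → φ j < φ i) ∧
      (∀ i < N, b < φ i) ∧
      ∀ i < N, ∃ (G : HMF 𝒜 d W) (f : F i ⟶ F (i + 1)) (g : F (i + 1) ⟶ G)
        (h : G ⟶ (F i)⟦(1 : ℤ)⟧),
        IsSemistable 𝒜 d W (φ i) G ∧ Triangle.mk f g h ∈ distTriang (HMF 𝒜 d W) := by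
  induction h with
  | zero b E h => exact ⟨0, fun _ => E, fun _ => 0, h, ⟨Iso.refl E⟩, by simp, by simp, by simp⟩
  | step b ψ E G _ hG h ih =>
    obtain ⟨N, F, φ, h₁, ⟨e⟩, h₃, h₄, h₅⟩ := ih
    -- The last term is built on `F N` itself rather than on the isomorphic `E`, so that the final
    -- split triangle starts at the previous term of the filtration.
    refine ⟨N + 1, fun i => if i ≤ N then F i else F N ⊞ G, fun i => if i < N then φ i else ψ,
      ?_, ?_, fun i j hij hj => ?_, fun i hi => ?_, fun i hi => ?_⟩
    · simpa using h₁
    · simpa using ⟨biprod.mapIso e (Iso.refl G)⟩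
    · have hi : i < N := by omega
      by_cases hj' : j < N
      · simpa [hi, hj'] using h₃ i j hij hj'
      · simpa [hi, hj'] using h₄ i hi
    · by_cases hi' : i < N
      · simpa [hi'] using h.trans (h₄ i hi')
      · simpa [hi'] using h
    -- Naming the property as a function of the two objects and the phase lets the conditionals be
    -- rewritten although the morphism types depend on them.
    · let Q (X Y : HMF 𝒜 d W) (ρ : ℝ) : Prop := ∃ (G : HMF 𝒜 d W) (f : X ⟶ Y) (g : Y ⟶ G)
        (h : G ⟶ X⟦(1 : ℤ)⟧), IsSemistable 𝒜 d W ρ G ∧ Triangle.mk f g h ∈ distTriang (HMF 𝒜 d W)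
      change Q (if i ≤ N then F i else F N ⊞ G) (if i + 1 ≤ N then F (i + 1) else F N ⊞ G)
        (if i < N then φ i else ψ)
      rw [if_pos (Nat.le_of_lt_succ hi)]
      rcases Nat.lt_succ_iff_lt_or_eq.1 hi with hi' | rfl
      · rw [if_pos (Nat.succ_le_of_lt hi'), if_pos hi']
        exact h₅ i hi'
      · rw [if_neg (by omega), if_neg (by omega)]
        exact ⟨G, biprod.inl, biprod.snd, 0, hG, binaryBiproductTriangle_distinguished (F i) G⟩
  | iso b E F' e _ ih =>
    obtain ⟨N, F, φ, h₁, ⟨e'⟩, h₃, h₄, h₅⟩ := ih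
    exact ⟨N, F, φ, h₁, ⟨e' ≪≫ e⟩, h₃, h₄, h₅⟩

end HMF

/-! ### Factorizations of rank one: contractibility, central charge and morphisms. -/

namespace GradedMF

open MvPolynomial

section

variable {A : Type} [CommRing A] [Algebra ℂ A] {𝒜 : ℤ → Submodule ℂ A} {d : ℤ} {W : A}

lemma sum_pair_eq {ι M : Type} [Fintype ι] [AddCommMonoid M] {i k : ι} (hik : i ≠ k)
    (h : ∀ j, j = i ∨ j = k) (f : ι → M) : ∑ j, f j = f i + f k := by
  classical
  rw [← Finset.sum_pair hik]
  refine (Finset.sum_subset (Finset.subset_univ _) fun j _ hj => ?_).symm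
  exact absurd (by simpa using h j) hj

lemma diff_self_eq_zero (P : GradedMF 𝒜 d W) (j : P.ι) : P.diff j j = 0 := by
  by_contra h
  rcases P.par_eq_add_one h with ⟨h₁, h₂⟩ | ⟨h₁, h₂⟩ <;> simp [h₁] at h₂

/-- The homotopy has the single entry `v`, inverse to the unit structure map; the diagonal entries
of `diff` vanish by parity, so its anticommutator with `diff` is the identity. -/
lemma homotopic_zero_of_unit [SetLike.GradedMonoid 𝒜] (P : GradedMF 𝒜 d W) {x y : P.ι}
    (hxy : x ≠ y) (h : ∀ j, j = x ∨ j = y) {v : A} (hv : P.diff y x * v = 1) {c : ℤ}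
    (hc : ((P.par y).val : ℤ) + -1 = (P.par x).val + 2 * c)
    (hdeg : v ∈ 𝒜 (P.deg x + d * c - P.deg y)) : Homotopic P P (𝟙 P) 0 := by
  refine ⟨Matrix.single x y v, fun p q => ?_, ?_⟩
  · by_cases hpq : x = p ∧ y = q
    · obtain ⟨rfl, rfl⟩ := hpq
      exact Or.inr ⟨c, hc, by simpa using hdeg⟩
    · exact Or.inl (by rw [Matrix.single_apply, if_neg hpq])
  · rw [mat_id, mat_zero, sub_zero]
    ext p q
    rw [Matrix.add_apply]
    have hx := P.diff_self_eq_zero x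
    have hy := P.diff_self_eq_zero y
    rcases h p with rfl | rfl <;> rcases h q with rfl | rfl <;>
      simp [Matrix.mul_apply, Matrix.single_apply, hxy, hxy.symm, sum_pair_eq hxy h,
        hx, hy, hv, mul_comm v]

/-- With `t` and `s` the half-sum and half-difference of the angles, the central charge is
`e^{it}(e^{-is} - e^{is}) = 2 sin s · e^{i(t - π/2)}`. -/
lemma str_of_rankOne (P : GradedMF 𝒜 d W) {i k : P.ι} (hi : P.par i = 0) (hk : P.par k = 1)
    (h : ∀ j, j = i ∨ j = k) :
    P.str = (2 * Real.sin (Real.pi * ((P.deg k - P.deg i : ℝ) / d)) : ℝ) *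
      Complex.exp (Complex.I * Real.pi * ((P.deg i + P.deg k : ℝ) / d - 1 / 2 : ℝ)) := by
  have hik : i ≠ k := by
    rintro rfl
    rw [hi] at hk
    exact absurd hk (by decide)
  rw [str, sum_pair_eq hik h, hi, hk]
  have h0 : (0 : ZMod 2).val = 0 := rfl
  have h1 : (1 : ZMod 2).val = 1 := rfl
  rw [h0, h1]
  push_cast
  set s : ℂ := Real.pi * ((P.deg k - P.deg i) / d)
  set t : ℂ := Real.pi * ((P.deg i + P.deg k) / d)
  have e₁ : 2 * Real.pi * Complex.I * P.deg i / d = t * Complex.I + -s * Complex.I := by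
    simp only [s, t]; ring
  have e₂ : 2 * Real.pi * Complex.I * P.deg k / d = t * Complex.I + s * Complex.I := by
    simp only [s, t]; ring
  have e₃ : Complex.I * Real.pi * ((P.deg i + P.deg k) / d - 1 / 2) =
      t * Complex.I + -Real.pi / 2 * Complex.I := by
    simp only [t]; ring
  rw [e₁, e₂, e₃, Complex.exp_add, Complex.exp_add, Complex.exp_add, Complex.exp_neg_pi_div_two_mul_I,
    Complex.sin]
  linear_combination (Complex.exp (t * Complex.I) * (Complex.exp (-s * Complex.I) -
    Complex.exp (s * Complex.I))) * Complex.I_mul_I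

lemma abs_gradedRank_of_rankOne_le (P : GradedMF 𝒜 d W) {i k : P.ι} (hi : P.par i = 0)
    (hk : P.par k = 1) (h : ∀ j, j = i ∨ j = k) (r : Fin d.natAbs) :
    |(gradedRank d P.toGradedSuperModule r : ℝ)| ≤ 1 := by
  have hik : i ≠ k := by
    rintro rfl
    rw [hi] at hk
    exact absurd hk (by decide)
  have h0 : (0 : ZMod 2).val = 0 := rfl
  have h1 : (1 : ZMod 2).val = 1 := rfl
  rw [gradedRank, sum_pair_eq hik h, hi, hk, h0, h1]
  split_ifs <;> simp

end

variable {a d : ℤ} {W : MvPolynomial (Fin 1) ℂ}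

/-- The only nonzero term in the diagonal entry of `diff²` is the product of the two structure maps,
and it equals `W`. -/
lemma rankOne_components {A : Type} [CommRing A] [Algebra ℂ A] {𝒜 : ℤ → Submodule ℂ A} {d : ℤ}
    {W : A} (hW : W ≠ 0) (P : GradedMF 𝒜 d W) {i k : P.ι} (hi : P.par i = 0) (hk : P.par k = 1)
    (h : ∀ j, j = i ∨ j = k) :
    P.diff k i ≠ 0 ∧ P.diff k i ∈ 𝒜 (P.deg k - P.deg i) ∧
      P.diff i k ≠ 0 ∧ P.diff i k ∈ 𝒜 (P.deg i + d - P.deg k) := by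
  have hne : P.diff i k * P.diff k i ≠ 0 := by
    obtain ⟨z, hz⟩ := P.exists_diff_mul_diff_ne_zero hW i
    rcases h z with rfl | rfl
    · simp [P.diff_self_eq_zero] at hz
    · exact hz
  refine ⟨right_ne_zero_of_mul hne, ?_, left_ne_zero_of_mul hne, ?_⟩
  · simpa using P.homogeneous.mem_of_par (k := k) (i := i) (c := 0) (by rw [hi, hk]; rfl)
  · simpa using P.homogeneous.mem_of_par (k := i) (i := k) (c := 1) (by rw [hi, hk]; rfl)

/-- The degrees of the structure maps of a matrix factorization of rank one are between `0` and
the degree of `W`; if one of them is trivial then the factorization is contractible. -/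
lemma rankOne_trichotomy (ha : a ≠ 0) (had : 0 < a * d) (hW : W ≠ 0)
    (P : GradedMF (weightedHomogeneousSubmodule ℂ (fun _ : Fin 1 => a)) d W) {i k : P.ι}
    (hi : P.par i = 0) (hk : P.par k = 1) (h : ∀ j, j = i ∨ j = k) :
    (P.deg k - P.deg i = 0 ∨ P.deg k - P.deg i = d) ∧ Homotopic P P (𝟙 P) 0 ∨
      0 < a * (P.deg k - P.deg i) ∧ a * (P.deg k - P.deg i) < a * d := by
  have hik : i ≠ k := by
    rintro rfl
    rw [hi] at hk
    exact absurd hk (by decide)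
  obtain ⟨h₁, h₁', h₂, h₂'⟩ := P.rankOne_components hW hi hk h
  by_cases hl : P.deg k - P.deg i = 0
  · left
    rw [hl] at h₁'
    obtain ⟨α, hα, hα'⟩ := exists_eq_C_of_mem_zero ha h₁' h₁
    refine ⟨Or.inl hl, P.homotopic_zero_of_unit hik h (v := C α⁻¹) (c := 0) ?_ ?_ ?_⟩
    · rw [hα', ← C_mul, mul_inv_cancel₀ hα, C_1]
    · rw [hi, hk]; rfl
    · rw [show P.deg i + d * 0 - P.deg k = 0 by omega]
      exact isWeightedHomogeneous_C _ _
  by_cases hr : P.deg k - P.deg i = d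
  · left
    rw [show P.deg i + d - P.deg k = 0 by omega] at h₂'
    obtain ⟨α, hα, hα'⟩ := exists_eq_C_of_mem_zero ha h₂' h₂
    -- Here the unit is `P¹ → P⁰(d)`, so the homotopy goes from `P⁰` to `P¹(-d)`; hence `c = -1`.
    refine ⟨Or.inr hr, P.homotopic_zero_of_unit hik.symm (fun j => (h j).symm) (v := C α⁻¹)
      (c := -1) ?_ ?_ ?_⟩
    · rw [hα', ← C_mul, mul_inv_cancel₀ hα, C_1]
    · rw [hi, hk]; rfl
    · rw [show P.deg k + d * -1 - P.deg i = 0 by omega]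
      exact isWeightedHomogeneous_C _ _
  right
  have h₃ : ¬ a * (P.deg k - P.deg i) < 0 := fun h => h₁ (eq_zero_of_mem_of_mul_neg ha h₁' h)
  have h₄ : ¬ a * (P.deg i + d - P.deg k) < 0 := fun h => h₂ (eq_zero_of_mem_of_mul_neg ha h₂' h)
  have h₅ : a * (P.deg k - P.deg i) ≠ 0 := mul_ne_zero ha hl
  have h₆ : a * (P.deg k - P.deg i) ≠ a * d := fun h => hr (mul_left_cancel₀ ha h)
  have h₇ : a * (P.deg i + d - P.deg k) = a * d - a * (P.deg k - P.deg i) := by ring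
  omega

/-- The vanishing holds before passing to homotopy classes: the degrees of the two components,
multiplied by `a`, have negative sum, so one component is zero, and the commuting square with
nonzero structure maps over a domain kills the other. -/
lemma hom_eq_zero_of_phase_lt (ha : a ≠ 0) (had : 0 < a * d) (hW : W ≠ 0)
    {P Q : GradedMF (weightedHomogeneousSubmodule ℂ (fun _ : Fin 1 => a)) d W} {φ ψ : ℝ}
    (hP : P.IsRankOneOfPhase φ) (hQ : Q.IsRankOneOfPhase ψ) (h : ψ < φ) (g : P ⟶ Q) : g = 0 := by
  obtain ⟨i, k, hi, hk, hP, rfl⟩ := hP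
  obtain ⟨i', k', hi', hk', hQ, rfl⟩ := hQ
  have hlt : a * (Q.deg i' - P.deg i) + a * (Q.deg k' - P.deg k) < 0 := by
    have hd : (d : ℝ) ≠ 0 := by
      rintro h
      have : d = 0 := by exact_mod_cast h
      simp [this] at had
    have had' : (0 : ℝ) < a * d := by exact_mod_cast had
    -- Multiplying the inequality of phases by `a d > 0` clears the denominator whatever the common
    -- sign of `a` and `d`.
    have h' : (Q.deg i' + Q.deg k' : ℝ) / d * (a * d) < (P.deg i + P.deg k : ℝ) / d * (a * d) :=
      mul_lt_mul_of_pos_right (by linarith) had'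
    have e : ∀ x : ℝ, x / d * (a * d) = a * x := fun x => by field_simp
    rw [e, e] at h'
    have : (a * (Q.deg i' + Q.deg k') : ℤ) < a * (P.deg i + P.deg k) := by exact_mod_cast h'
    linarith
  have hik : i ≠ k := by
    rintro rfl
    rw [hi] at hk
    exact absurd hk (by decide)
  have hik' : i' ≠ k' := by
    rintro rfl
    rw [hi'] at hk'
    exact absurd hk' (by decide)
  have m₁ : mat g i' i ∈ weightedHomogeneousSubmodule ℂ (fun _ : Fin 1 => a)
      (Q.deg i' - P.deg i) := by
    simpa using (homogeneous_mat g).mem_of_par (k := i') (i := i) (c := 0) (by rw [hi, hi']; rfl)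
  have m₂ : mat g k' k ∈ weightedHomogeneousSubmodule ℂ (fun _ : Fin 1 => a)
      (Q.deg k' - P.deg k) := by
    simpa using (homogeneous_mat g).mem_of_par (k := k') (i := k) (c := 0) (by rw [hk, hk']; rfl)
  have z₁ : mat g i' k = 0 := ((homogeneous_mat g) i' k).resolve_right (by
    rintro ⟨c, hc, -⟩
    rw [hk, hi', show (1 : ZMod 2).val = 1 from rfl, show (0 : ZMod 2).val = 0 from rfl] at hc
    push_cast at hc
    omega)
  have z₂ : mat g k' i = 0 := ((homogeneous_mat g) k' i).resolve_right (by
    rintro ⟨c, hc, -⟩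
    rw [hi, hk', show (1 : ZMod 2).val = 1 from rfl, show (0 : ZMod 2).val = 0 from rfl] at hc
    push_cast at hc
    omega)
  have hcomm : mat g k' k * P.diff k i = Q.diff k' i' * mat g i' i := by
    have := congrFun (congrFun (comm g) k') i
    rw [Matrix.mul_apply, Matrix.mul_apply, sum_pair_eq hik hP, sum_pair_eq hik' hQ, z₂] at this
    simpa using this
  have hz : mat g k' k = 0 ∧ mat g i' i = 0 := by
    rcases lt_or_ge (a * (Q.deg i' - P.deg i)) 0 with hneg | hnn
    · have h0 := eq_zero_of_mem_of_mul_neg ha m₁ hneg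
      rw [h0, mul_zero] at hcomm
      exact ⟨(mul_eq_zero.1 hcomm).resolve_right (P.rankOne_components hW hi hk hP).1, h0⟩
    · have h0 := eq_zero_of_mem_of_mul_neg ha m₂ (by linarith)
      rw [h0, zero_mul] at hcomm
      exact ⟨h0, (mul_eq_zero.1 hcomm.symm).resolve_left (Q.rankOne_components hW hi' hk' hQ).1⟩
  refine hom_ext (Matrix.ext fun p q => ?_)
  rw [mat_zero, Matrix.zero_apply]
  rcases hQ p with rfl | rfl <;> rcases hP q with rfl | rfl
  exacts [hz.2, z₁, z₂, hz.1]

end GradedMF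

/-! ### Uniform estimates and the stability condition. -/

lemma exists_one_le_mul_sin (N : ℕ) :
    ∃ c : ℝ, ∀ l : ℕ, 0 < l → l < N → 0 < Real.sin (Real.pi * (l / N)) ∧
      1 ≤ c * (2 * Real.sin (Real.pi * (l / N))) := by
  have hpos : ∀ l : ℕ, 0 < l → l < N → 0 < Real.sin (Real.pi * (l / N)) := fun l h₀ h₁ => by
    have hN : (0 : ℝ) < N := by exact_mod_cast h₀.trans h₁
    refine Real.sin_pos_of_pos_of_lt_pi (by positivity) ?_
    have : (l : ℝ) / N < 1 := (div_lt_one hN).2 (by exact_mod_cast h₁)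
    nlinarith [Real.pi_pos]
  -- The sum of the finitely many positive reciprocals dominates each of them, so it serves as a
  -- uniform constant.
  refine ⟨∑ l ∈ Finset.Ioo 0 N, (2 * Real.sin (Real.pi * (l / N)))⁻¹, fun l h₀ h₁ =>
    ⟨hpos l h₀ h₁, ?_⟩⟩
  have h := hpos l h₀ h₁
  rw [← div_le_iff₀ (by positivity), one_div]
  refine Finset.single_le_sum (f := fun l : ℕ => (2 * Real.sin (Real.pi * (l / N)))⁻¹)
    (fun j hj => ?_) (Finset.mem_Ioo.2 ⟨h₀, h₁⟩)
  have := hpos j (Finset.mem_Ioo.1 hj).1 (Finset.mem_Ioo.1 hj).2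
  positivity

namespace HMF

open GradedMF Pretriangulated MvPolynomial

variable {a d : ℤ} {W : MvPolynomial (Fin 1) ℂ}

lemma constantCoeff_homogeneous (e : ℤ) (he : e ≠ 0)
    (f : MvPolynomial (Fin 1) ℂ) (hf : f ∈ weightedHomogeneousSubmodule ℂ (fun _ : Fin 1 => a) e) :
    constantCoeff f = 0 := constantCoeff_eq_zero_of_mem hf he

lemma exists_central_charge_of_rankOne (ha : a ≠ 0) (had : 0 < a * d) (hW : W ≠ 0) :
    ∃ c : ℝ, ∀ φ, ∀ P : GradedMF (weightedHomogeneousSubmodule ℂ (fun _ : Fin 1 => a)) d W,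
      P.IsRankOneOfPhase φ → ∃ r : ℝ, 0 ≤ r ∧
        P.str = r * Complex.exp (Complex.I * Real.pi * φ) ∧
        (r = 0 → IsZero ((quot _ d W).obj P)) ∧
        ∀ i, |(GradedMF.gradedRank d P.toGradedSuperModule i : ℝ)| ≤ c * r := by
  have hd : d ≠ 0 := right_ne_zero_of_mul had.ne'
  have hd' : (d : ℝ) ≠ 0 := by exact_mod_cast hd
  obtain ⟨c, hc⟩ := exists_one_le_mul_sin d.natAbs
  refine ⟨c, ?_⟩
  rintro φ P ⟨i, k, hi, hk, h, rfl⟩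
  have hstr := P.str_of_rankOne hi hk h
  rcases rankOne_trichotomy ha had hW P hi hk h with ⟨hx, hP⟩ | ⟨h₁, h₂⟩
  · have hz := isZero_quot_obj hP
    -- In the contractible case the rank and the sine both vanish, so `r = 0` satisfies every
    -- clause.
    have hr : gradedRank ((quot _ d W).obj P) = 0 := gradedRank_of_isZero constantCoeff_homogeneous hz
    have hx' : Real.sin (Real.pi * ((P.deg k - P.deg i : ℝ) / d)) = 0 := by
      rcases hx with hx | hx
      · have : (P.deg k - P.deg i : ℝ) = 0 := by exact_mod_cast hx
        simp [this]
      · have : (P.deg k - P.deg i : ℝ) = d := by exact_mod_cast hx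
        simp [this, hd']
    rw [hx', mul_zero] at hstr
    refine ⟨0, le_rfl, hstr, fun _ => hz, fun j => ?_⟩
    have hj : GradedMF.gradedRank d P.toGradedSuperModule j = 0 := congrFun hr j
    simp [hj]
  -- The numbers `n - m` and `d` both have the sign of `a`, so their quotient is that of absolute
  -- values, one of the finitely many fractions in the sine estimate.
  · have hl : 0 < (P.deg k - P.deg i).natAbs ∧ (P.deg k - P.deg i).natAbs < d.natAbs ∧
        (P.deg k - P.deg i : ℝ) / d = ((P.deg k - P.deg i).natAbs : ℝ) / d.natAbs := by
      rcases lt_or_gt_of_ne ha with ha | ha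
      · have h₃ : P.deg k - P.deg i < 0 := by nlinarith
        have h₄ : d < P.deg k - P.deg i := by nlinarith
        refine ⟨by omega, by omega, ?_⟩
        rw [Nat.cast_natAbs, Nat.cast_natAbs, abs_of_neg h₃, abs_of_neg (by omega)]
        push_cast
        rw [neg_div_neg_eq]
      · have h₃ := pos_of_mul_pos_right h₁ ha.le
        have h₄ := lt_of_mul_lt_mul_left h₂ ha.le
        refine ⟨by omega, by omega, ?_⟩
        rw [Nat.cast_natAbs, Nat.cast_natAbs, abs_of_pos h₃, abs_of_pos (by omega)]
        push_cast
        rfl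
    rw [hl.2.2] at hstr
    obtain ⟨hs, hs'⟩ := hc _ hl.1 hl.2.1
    refine ⟨_, by positivity, hstr, fun h0 => ?_, fun j =>
      (P.abs_gradedRank_of_rankOne_le hi hk h j).trans hs'⟩
    linarith

/-- Within one phase the central charges lie on a common ray, so their lengths add while the rank is
subadditive; the rank one constant therefore works for all direct sums. -/
lemma exists_central_charge (ha : a ≠ 0) (had : 0 < a * d) (hW : W ≠ 0) :
    ∃ c : ℝ, ∀ φ E, IsSemistable (weightedHomogeneousSubmodule ℂ (fun _ : Fin 1 => a)) d W φ E →
      ∃ r : ℝ, 0 ≤ r ∧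
        evalRootOfUnity d (gradedRank E) = r * Complex.exp (Complex.I * Real.pi * φ) ∧
        (r = 0 → IsZero E) ∧ ∀ i, |(gradedRank E i : ℝ)| ≤ c * r := by
  have hd : d ≠ 0 := right_ne_zero_of_mul had.ne'
  obtain ⟨c, hc⟩ := exists_central_charge_of_rankOne (d := d) ha had hW
  refine ⟨c, fun φ E hE => ?_⟩
  induction hE with
  | zero E h =>
    rw [gradedRank_of_isZero constantCoeff_homogeneous h]
    exact ⟨0, le_rfl, by simp, fun _ => h, by simp⟩
  | rankOne P h =>
    obtain ⟨r, h₁, h₂, h₃⟩ := hc φ P h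
    exact ⟨r, h₁, (evalRootOfUnity_gradedRank hd P).trans h₂, h₃⟩
  | biprod E F _ _ hE hF =>
    obtain ⟨r, h₁, h₂, h₃, h₄⟩ := hE
    obtain ⟨r', h₁', h₂', h₃', h₄'⟩ := hF
    rw [gradedRank_biprod constantCoeff_homogeneous]
    refine ⟨r + r', by positivity, ?_, fun h => ?_, fun i => ?_⟩
    · rw [map_add, h₂, h₂']
      push_cast
      ring
    · exact (biprod_isZero_iff E F).2 ⟨h₃ (by linarith), h₃' (by linarith)⟩
    · rw [Pi.add_apply, Int.cast_add, mul_add]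
      exact (abs_add_le _ _).trans (add_le_add (h₄ i) (h₄' i))
  | iso E F e _ ih =>
    obtain ⟨r, h₁, h₂, h₃, h₄⟩ := ih
    rw [← gradedRank_eq_of_iso constantCoeff_homogeneous e]
    exact ⟨r, h₁, h₂, fun h => (h₃ h).of_iso e.symm, h₄⟩

lemma IsSemistable.hom_eq_zero (ha : a ≠ 0) (had : 0 < a * d) (hW : W ≠ 0) {φ ψ : ℝ} (h : ψ < φ)
    {E F : HMF (weightedHomogeneousSubmodule ℂ (fun _ : Fin 1 => a)) d W}
    (hE : IsSemistable _ d W φ E) (hF : IsSemistable _ d W ψ F) (f : E ⟶ F) : f = 0 := by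
  induction hE with
  | zero E h => exact h.eq_of_src _ _
  | rankOne P hP =>
    induction hF with
    | zero F h => exact h.eq_of_tgt _ _
    | rankOne Q hQ =>
      obtain ⟨g, rfl⟩ := quot_map_surjective f
      rw [hom_eq_zero_of_phase_lt ha had hW hP hQ h g, Functor.map_zero]
    | biprod F F' _ _ hF hF' =>
      exact biprod.hom_ext _ _ ((hF _).trans zero_comp.symm) ((hF' _).trans zero_comp.symm)
    | iso F F' e _ hF => rw [← Category.comp_id f, ← e.inv_hom_id, ← Category.assoc, hF (f ≫ e.inv), zero_comp]
  | biprod E E' _ _ hE hE' =>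
    exact biprod.hom_ext' _ _ ((hE _).trans comp_zero.symm) ((hE' _).trans comp_zero.symm)
  | iso E E' e _ hE => rw [← Category.id_comp f, ← e.inv_hom_id, Category.assoc, hE (e.hom ≫ f), comp_zero]

lemma exists_hasHN (ha : a ≠ 0) (hW : W ≠ 0)
    (P : GradedMF (weightedHomogeneousSubmodule ℂ (fun _ : Fin 1 => a)) d W) :
    ∃ b, HasHN _ d W b ((quot _ d W).obj P) := by
  induction hn : Fintype.card P.ι using Nat.strong_induction_on generalizing P with
  | _ n ih =>
    rcases isEmpty_or_nonempty P.ι with hP | hP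
    · exact ⟨0, .zero _ _ (isZero_quot_obj ⟨0, .zero, Matrix.ext fun i => isEmptyElim i⟩)⟩
    · obtain ⟨M, Q, φ, hM, hQ, ⟨e⟩⟩ := P.exists_iso_biprod ha hW hP
      obtain ⟨b, hb⟩ := ih _ (hn ▸ hQ) Q rfl
      -- Any number at most `b` and strictly below `φ` would do as the new lower bound.
      refine ⟨min b (φ - 1), .iso _ _ _ e.symm
        ((hb.mono (min_le_left _ _)).biprod (.rankOne M hM) ?_)⟩
      exact (min_le_right _ _).trans_lt (by linarith)

/-- The stability condition `σ_G`. -/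
noncomputable def gepnerStabilityCondition (ha : a ≠ 0) (had : 0 < a * d) (hW : W ≠ 0) :
    StabilityCondition (HMF (weightedHomogeneousSubmodule ℂ (fun _ : Fin 1 => a)) d W) where
  Z := (evalRootOfUnity d).comp (gradedRankHom constantCoeff_homogeneous)
  P φ := IsSemistable _ d W φ
  iso_closed _ := ⟨fun e hE => .iso _ _ e hE⟩
  zero_mem _ E h := .zero E h
  biprod_mem _ E F hE hF := .biprod E F hE hF
  central_charge φ E hE h0 := by
    obtain ⟨c, hc⟩ := exists_central_charge ha had hW
    obtain ⟨r, h₁, h₂, h₃, -⟩ := hc φ E hE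
    exact ⟨r, lt_of_le_of_ne h₁ fun h => h0 (h₃ h.symm), by
      rw [AddMonoidHom.comp_apply, gradedRankHom_mk, h₂]⟩
  shift φ := (isSemistable_map_shift (right_ne_zero_of_mul had.ne') φ).symm
  hom_eq_zero _ _ h _ _ hE hF f := hE.hom_eq_zero ha had hW h hF f
  harder_narasimhan E _ := by
    obtain ⟨b, hb⟩ := exists_hasHN ha hW E.as
    obtain ⟨N, F, φ, h₁, h₂, h₃, -, h₄⟩ := hb.exists_filtration
    exact ⟨N, F, φ, h₁, h₂, h₃, h₄⟩

lemma gepnerStabilityCondition_Z (ha : a ≠ 0) (had : 0 < a * d) (hW : W ≠ 0)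
    (P : GradedMF (weightedHomogeneousSubmodule ℂ (fun _ : Fin 1 => a)) d W) :
    (gepnerStabilityCondition ha had hW).Z (.mk ((quot _ d W).obj P)) = P.str := by
  change evalRootOfUnity d (gradedRankHom constantCoeff_homogeneous _) = _
  rw [gradedRankHom_mk]
  exact evalRootOfUnity_gradedRank (right_ne_zero_of_mul had.ne') P

lemma gepnerStabilityCondition_hasSupportProperty (ha : a ≠ 0) (had : 0 < a * d) (hW : W ≠ 0) :
    (gepnerStabilityCondition ha had hW).HasSupportProperty := by
  obtain ⟨c, hc⟩ := exists_central_charge ha had hW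
  refine ⟨_, gradedRankHom constantCoeff_homogeneous, evalRootOfUnity d, rfl, c,
    fun φ E hE i => ?_⟩
  obtain ⟨r, h₁, h₂, -, h₄⟩ := hc φ E hE
  -- The exponential of a purely imaginary number has norm 1, so the estimate in terms of `r` is the
  -- support property.
  have hZ : ‖(gepnerStabilityCondition ha had hW).Z (.mk E)‖ = r := by
    change ‖evalRootOfUnity d (gradedRankHom constantCoeff_homogeneous _)‖ = _
    rw [gradedRankHom_mk, h₂, norm_mul, Complex.norm_real, Real.norm_of_nonneg h₁,
      show Complex.I * Real.pi * φ = ((Real.pi * φ : ℝ) : ℂ) * Complex.I by push_cast; ring,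
      Complex.norm_exp_ofReal_mul_I, mul_one]
  rw [hZ, gradedRankHom_mk]
  exact h₄ i

end HMF

/-! ### The Gepner property, and the sign of `a d`. -/

lemma GradedMF.str_twist {A : Type} [CommRing A] [Algebra ℂ A] {𝒜 : ℤ → Submodule ℂ A}
    [SetLike.GradedMonoid 𝒜] {d : ℤ} {W : A} (P : GradedMF 𝒜 d W) (r : ℤ) :
    (P.twist r).str = Complex.exp (2 * Real.pi * Complex.I * r / d) * P.str := by
  change ∑ j : P.ι, (-1) ^ (P.par j).val *
    Complex.exp (2 * Real.pi * Complex.I * ((P.deg j + r : ℤ) : ℂ) / d) = _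
  rw [GradedMF.str, Finset.mul_sum]
  refine Finset.sum_congr rfl fun j _ => ?_
  rw [mul_left_comm, ← Complex.exp_add]
  push_cast
  ring_nf

namespace HMF

open GradedMF Pretriangulated MvPolynomial

variable {a d : ℤ} {W : MvPolynomial (Fin 1) ℂ}

lemma gepnerStabilityCondition_isGepnerType (ha : a ≠ 0) (had : 0 < a * d) (hW : W ≠ 0) :
    (gepnerStabilityCondition ha had hW).IsGepnerType (gradeShift _ d W) (2 / d) := by
  refine ⟨fun E => ?_, fun φ => ?_⟩
  · obtain ⟨P⟩ := E
    -- The inverse of the grade shift is represented by `P(-1)`, which multiplies the supertrace by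
    -- `e^{-2πi/d}`.
    refine (gepnerStabilityCondition_Z ha had hW (P.twist (-1))).trans ?_
    rw [str_twist]
    refine congrArg₂ _ (congrArg _ ?_) (gepnerStabilityCondition_Z ha had hW P).symm
    push_cast
    ring
  · have h : ((2 / d : ℂ)).re = (2 / d : ℝ) := by
      rw [← Complex.ofReal_re (2 / d : ℝ)]
      push_cast
      rfl
    rw [h]
    exact isSemistable_map_gradeShift (right_ne_zero_of_mul had.ne') φ

end HMF

/-- The zero polynomial would be singular at the point with all coordinates 1. -/
lemma IsSmoothAwayFromOrigin.ne_zero {n : ℕ} [NeZero n] {W : MvPolynomial (Fin n) ℂ}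
    (hW : IsSmoothAwayFromOrigin W) : W ≠ 0 := by
  rintro rfl
  have := hW.2 1 (by simp) (by simp)
  exact one_ne_zero (congrFun this 0)

/-- If `a d < 0` then `W` vanishes for degree reasons; if `d = 0` then `W` is a nonzero constant,
contradicting `W(0) = 0`. -/
lemma mul_pos_of_isSmoothAwayFromOrigin {a d : ℤ} (ha : a ≠ 0) {W : MvPolynomial (Fin 1) ℂ}
    (hW : MvPolynomial.IsWeightedHomogeneous (fun _ => a) W d) (hW' : IsSmoothAwayFromOrigin W) :
    0 < a * d := by
  by_contra h
  rcases lt_or_eq_of_le (not_lt.1 h) with h | h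
  · exact hW'.ne_zero (MvPolynomial.eq_zero_of_mem_of_mul_neg ha hW h)
  · obtain rfl : d = 0 := (mul_eq_zero.1 h).resolve_left ha
    obtain ⟨α, hα, rfl⟩ := MvPolynomial.exists_eq_C_of_mem_zero ha hW hW'.ne_zero
    exact hα (by simpa using hW'.1)

theorem mainTheorem8 (a d : ℤ) (ha : a ≠ 0) (W : MvPolynomial (Fin 1) ℂ)
    (hW : MvPolynomial.IsWeightedHomogeneous (fun _ => a) W d) (hW' : IsSmoothAwayFromOrigin W) :
    GepnerConjecture (fun _ => a) d W := by
  have had := mul_pos_of_isSmoothAwayFromOrigin ha hW hW'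
  exact ⟨HMF.gepnerStabilityCondition ha had hW'.ne_zero,
    HMF.gepnerStabilityCondition_hasSupportProperty ha had hW'.ne_zero,
    HMF.gepnerStabilityCondition_Z ha had hW'.ne_zero,
    HMF.gepnerStabilityCondition_isGepnerType ha had hW'.ne_zero⟩
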